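/- Let $V$ be a real locally convex space, $V'$ its topological dual with the weak-$*$-topology, and $V_{\mathbb C}=V\oplus iV$ its complexification; each $f\in V'$ is extended complex linearly to $V_{\mathbb C}$. For $C\subseteq V'$ put $\langle C,v\rangle=\{f(v):f\in C\}$, $B(C)=\{v\in V:\inf\langle C,v\rangle>-\infty\}$, $s_C(v)=-\inf\langle C,v\rangle$ for $v\in B(C)$, and let $B(C)^0$ be the interior of $B(C)$. Smooth maps between locally convex spaces are understood in the sense of Michal–Bastiani, and a holomorphic map is a smooth map with complex linear differentials. A complex involutive semigroup is a complex manifold modeled on a locally convex space with a holomorphic associative multiplication and an antiholomorphic involutive antiautomorphism $s\mapsto s^*$. An absolute value on such a semigroup $S$ is a function $\alpha:S\to[0,\infty)$ with $\alpha(s^*)=\alpha(s)$ and $\alpha(st)\le\alpha(s)\alpha(t)$. A morphism of involutive semigroups $\beta:S\to\mathcal A$ into the multiplicative semigroup of a $C^*$-algebra is $\alpha$-bounded if $\|\beta(s)\|\le\alpha(s)$ for all $s$. For a locally bounded absolute value $\alpha$, $C^*(S,\alpha)$ is the $C^*$-completion of the semigroup algebra $\mathbb C[S]$ (modulo the null space)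 for the seminorm $\|\sum_s c_s\delta_s\|=\sup_\beta\|\sum_s c_s\beta(s)\|$, the supremum being over all $\alpha$-bounded holomorphic morphisms $\beta$ of $S$ into $C^*$-algebras; $\eta_\alpha:S\to C^*(S,\alpha)$ is the canonical map. For a $C^*$-algebra $\mathcal A$ with multiplier algebra $M(\mathcal A)$, each non-degenerate representation $\pi$ of $\mathcal A$ on a Hilbert space has a unique extension $\tilde\pi$ to $M(\mathcal A)$, and each state $\varphi=\langle\pi(\cdot)v,v\rangle$ ($\pi$ non-degenerate, $\|v\|=1$) has a canonical extension $\tilde\varphi=\langle\tilde\pi(\cdot)v,v\rangle$ to $M(\mathcal A)$. Let $\eta:V\to U(M(\mathcal A))$ be a homomorphism into the unitary group. The pair $(\mathcal A,\eta)$ is a host algebra of $V$ if for each non-degenerate representation $\pi$ of $\mathcal A$ the unitary representation $\tilde\pi\circ\eta$ of $V$ is (strongly) continuous, and for each complex Hilbert space $\mathcal H$ the map $\pi\mapsto\tilde\pi\circ\eta$ is injective on the non-degenerate representations of $\mathcal A$ on $\mathcal H$. The multiplier action $\eta$ is strictly smooth if the set of all $a\in\mathcal A$ for which the maps $x\mapsto\eta(x)a$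 and $x\mapsto a\eta(x)$ are smooth on $V$ is dense in $\mathcal A$. The momentum set $I_\eta\subseteq V'$ is the weak-$*$-closure of the set of all functionals $\frac1i\,d(\tilde\varphi\circ\eta)(0)$, where $\varphi$ runs through the states of $\mathcal A$ for which $\tilde\varphi\circ\eta$ is smooth. **Theorem.** Let $C\subseteq V'$ be a non-empty weak-$*$-closed convex subset such that $B(C)^0\ne\emptyset$ and $s_C$ is locally bounded on $B(C)^0$. Then: 1. $S:=V+iB(C)^0$, with addition and the involution $(x+iy)^*=-x+iy$, is an open complex involutive subsemigroup of $V_{\mathbb C}$, and $\alpha_C(x+iy):=e^{-\inf\langle C,y\rangle}$ is a locally bounded absolute value on $S$. 2. $C$ is locally compact in the weak-$*$-topology. 3. The formula $\gamma(s)(f):=e^{if(s)}$ defines an $\alpha_C$-bounded holomorphic morphism $\gamma:S\to C_0(C)$ of involutive semigroups, and $\gamma$ induces an isomorphism of $C^*$-algebras $\Phi:C^*(S,\alpha_C)\to C_0(C)$, that is, $\Phi\circ\eta_{\alpha_C}=\gamma$. 4. The homomorphism $\eta:V\to C(C,\mathbb T)=U(M(C_0(C)))$, $\eta(x)(f):=e^{if(x)}$,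 where $C(C,\mathbb T)$ acts on $C_0(C)$ by multiplication, makes $(C_0(C),\eta)$ a host algebra of $V$ with a strictly smooth multiplier action, and its momentum set is $I_\eta=C$. -/

import Mathlib

open Set Filter Topology
open scoped MultiplierAlgebra ZeroAtInfty ENNReal

universe u v w

/-! ## Smooth and holomorphic maps between locally convex spaces -/

namespace HostTube

/-- `y` is the directional derivative of `f` at `x` in the direction `h`, that is,
`y = lim_{t → 0} (f (x + t h) - f x) / t` with `t` real and nonzero. -/
def HasDirDeriv {X : Type u} {Y : Type v} [AddCommGroup X] [Module ℝ X]
    [AddCommGroup Y] [Module ℝ Y] [TopologicalSpace Y] (f : X → Y) (x h : X) (y : Y) : Prop :=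
  Tendsto (fun t : ℝ => t⁻¹ • (f (x + t • h) - f x)) (𝓝[≠] 0) (𝓝 y)

/-- `f` is of class `C^n` on the open set `U` (in the sense of Michal and Bastiani):
`C^0` means continuous; `C^(n+1)` means that `f` is continuous, that all directional derivatives
`df(x)(h)`, `x ∈ U`, exist, and that `df : U × X → Y` is of class `C^n`. -/
def IsCn {Y : Type v} [AddCommGroup Y] [Module ℝ Y] [TopologicalSpace Y] :
    ℕ → ∀ {X : Type u} [AddCommGroup X] [Module ℝ X] [TopologicalSpace X],
      Set X → (X → Y) → Prop
  | 0, _, _, _, _, U, f => ContinuousOn f U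
  | n + 1, X, _, _, _, U, f =>
      ContinuousOn f U ∧ ∃ df : X × X → Y,
        (∀ x ∈ U, ∀ h : X, HasDirDeriv f x h (df (x, h))) ∧
          IsCn n (U ×ˢ (univ : Set X)) df

/-- `f` is smooth (`C^∞`) on the open set `U`. -/
def SmoothOn {X : Type u} {Y : Type v} [AddCommGroup X] [Module ℝ X] [TopologicalSpace X]
    [AddCommGroup Y] [Module ℝ Y] [TopologicalSpace Y] (U : Set X) (f : X → Y) : Prop :=
  ∀ n : ℕ, IsCn n U f

/-- `f` is holomorphic on the open set `U`: it is smooth and its differentials are complex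
linear. The real structures are those underlying the given complex ones. -/
def HolomorphicOn {X : Type u} {Y : Type v} [AddCommGroup X] [Module ℂ X] [TopologicalSpace X]
    [AddCommGroup Y] [Module ℂ Y] [TopologicalSpace Y] (U : Set X) (f : X → Y) : Prop :=
  SmoothOn U f ∧ ∀ x ∈ U, ∃ L : X →ₗ[ℂ] Y, ∀ h : X, HasDirDeriv f x h (L h)

/-- `f` is antiholomorphic on the open set `U`: it is smooth and its differentials are complex
antilinear. -/
def AntiholomorphicOn {X : Type u} {Y : Type v} [AddCommGroup X] [Module ℂ X]
    [TopologicalSpace X] [AddCommGroup Y] [Module ℂ Y] [TopologicalSpace Y]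
    (U : Set X) (f : X → Y) : Prop :=
  SmoothOn U f ∧ ∀ x ∈ U, ∃ L : X →ₛₗ[starRingEnd ℂ] Y, ∀ h : X, HasDirDeriv f x h (L h)

/-- `α` is locally bounded on `S`: every point of `S` has a neighbourhood in `S` on which `α` is
bounded. -/
def LocallyBoundedOn {X : Type u} [TopologicalSpace X] (S : Set X) (α : X → ℝ) : Prop :=
  ∀ x ∈ S, ∃ U ∈ 𝓝[S] x, ∃ M : ℝ, ∀ y ∈ U, |α y| ≤ M

/-! ## Complex involutive semigroups (carried by open sets) and their C⋆-algebras -/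

/-- The open subset `S` of the complex space `E` is a complex involutive semigroup with respect
to the multiplication `mul` and the involution `st`: `S` is closed under both, `mul` is associative
and holomorphic on `S × S`, and `st` is an involutive antiholomorphic antiautomorphism.
Only the values of `mul` on `S × S` and of `st` on `S` matter. -/
structure IsComplexInvSemigroup {E : Type u} [AddCommGroup E] [Module ℂ E] [TopologicalSpace E]
    (S : Set E) (mul : E → E → E) (st : E → E) : Prop where
  isOpen : IsOpen S
  mul_mem : ∀ a ∈ S, ∀ b ∈ S, mul a b ∈ S
  mul_assoc : ∀ a ∈ S, ∀ b ∈ S, ∀ c ∈ S, mul (mul a b) c = mul a (mul b c)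
  st_mem : ∀ a ∈ S, st a ∈ S
  st_st : ∀ a ∈ S, st (st a) = a
  st_mul : ∀ a ∈ S, ∀ b ∈ S, st (mul a b) = mul (st b) (st a)
  holomorphic_mul : HolomorphicOn (S ×ˢ S) (fun p : E × E => mul p.1 p.2)
  antiholomorphic_st : AntiholomorphicOn S st

/-- `α : S → [0, ∞)` is an absolute value on the involutive semigroup `S`. -/
structure IsSemigroupAbsValue {E : Type u} (S : Set E) (mul : E → E → E) (st : E → E)
    (α : E → ℝ) : Prop where
  nonneg : ∀ s ∈ S, 0 ≤ α s
  map_st : ∀ s ∈ S, α (st s) = α s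
  map_mul_le : ∀ s ∈ S, ∀ t ∈ S, α (mul s t) ≤ α s * α t

/-- An `α`-bounded holomorphic morphism of involutive semigroups from `S` to the multiplicative
semigroup of the C⋆-algebra `A`. The values of `toFun` outside `S` play no role. -/
structure HolMorphism {E : Type u} [AddCommGroup E] [Module ℂ E] [TopologicalSpace E]
    (S : Set E) (mul : E → E → E) (st : E → E) (α : E → ℝ)
    (A : Type v) [NonUnitalCStarAlgebra A] where
  toFun : E → A
  map_mul : ∀ s ∈ S, ∀ t ∈ S, toFun (mul s t) = toFun s * toFun t
  map_st : ∀ s ∈ S, toFun (st s) = star (toFun s)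
  bounded : ∀ s ∈ S, ‖toFun s‖ ≤ α s
  holomorphic : HolomorphicOn S toFun

/-- A C⋆-algebra together with an `α`-bounded holomorphic morphism from `S` into it. -/
structure Target {E : Type u} [AddCommGroup E] [Module ℂ E] [TopologicalSpace E]
    (S : Set E) (mul : E → E → E) (st : E → E) (α : E → ℝ) where
  A : Type u
  [cstar : NonUnitalCStarAlgebra A]
  hom : HolMorphism S mul st α A

attribute [instance] Target.cstar

section CStar

variable {E : Type u} [AddCommGroup E] [Module ℂ E] [TopologicalSpace E]
  (S : Set E) (mul : E → E → E) (st : E → E) (α : E → ℝ)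

/-- The `ℓ^∞`-product of all C⋆-algebras `A` over all `α`-bounded holomorphic morphisms
`β : S → A`. -/
abbrev TargetProd : Type (u + 1) := lp (fun i : Target S mul st α => i.A) ∞

/-- The family `(β s)_β`, for `s ∈ S`. -/
noncomputable def universalMap (s : S) : TargetProd S mul st α :=
  ⟨fun i => i.hom.toFun s, memℓp_infty ⟨α s, by
    rintro _ ⟨i, rfl⟩
    exact i.hom.bounded s s.2⟩⟩

/-- The C⋆-algebra `C⋆(S, α)`: the completion of the semigroup algebra `ℂ[S]` (modulo the null
space; equivalently, of a quotient of `ℓ¹(S, α)`) for the seminorm `‖f‖ = sup_β ‖∑ f(s) β(s)‖`,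
where `β` runs through the `α`-bounded holomorphic morphisms of involutive semigroups from `S` to
C⋆-algebras. By its definition, this seminorm is the norm of the image of `f` in the
`ℓ^∞`-product over all `β`, so that the completion is the closed `⋆`-subalgebra generated by the
elements `(β s)_β`, `s ∈ S`. It suffices to let the targets run through one universe, since the
closed subalgebra generated by `β(S)` has a copy in the universe of `S`. -/
noncomputable def semigroupCStar : NonUnitalStarSubalgebra ℂ (TargetProd S mul st α) :=
  (NonUnitalStarAlgebra.adjoin ℂ (range (universalMap S mul st α))).topologicalClosure

/-- The canonical map `η_α : S → C⋆(S, α)`. -/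
noncomputable def etaCStar (s : S) : semigroupCStar S mul st α :=
  ⟨universalMap S mul st α s,
    NonUnitalStarSubalgebra.le_topologicalClosure _
      (NonUnitalStarAlgebra.subset_adjoin ℂ _ (mem_range_self s))⟩

end CStar

/-! ## Host algebras, strict smoothness, momentum sets -/

section Host

variable {A : Type u} [NonUnitalCStarAlgebra A]

/-- Non-degenerate representation of a C⋆-algebra. -/
def IsNondegenerate {H : Type w} [NormedAddCommGroup H] [InnerProductSpace ℂ H] [CompleteSpace H]
    (π : A →⋆ₙₐ[ℂ] (H →L[ℂ] H)) : Prop :=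
  ∀ v : H, (∀ a : A, π a v = 0) → v = 0

/-- `ρ` extends `π` from `A` to the multiplier algebra `M(A)`. A non-degenerate `π` has exactly
one such extension. -/
def IsMultiplierExtension {H : Type w} [NormedAddCommGroup H] [InnerProductSpace ℂ H]
    [CompleteSpace H] (π : A →⋆ₙₐ[ℂ] (H →L[ℂ] H)) (ρ : 𝓜(ℂ, A) →⋆ₐ[ℂ] (H →L[ℂ] H)) : Prop :=
  ∀ a : A, ρ (a : 𝓜(ℂ, A)) = π a

/-- `(A, η)` is a host algebra for the topological group `G`: for every non-degenerate
representation `π` of `A` with extension `ρ` to `M(A)`, the unitary representation `ρ ∘ η` of `G`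
is (strongly) continuous, and `π ↦ ρ ∘ η` is injective on the non-degenerate
representations of `A` on any given complex Hilbert space. -/
def IsHostAlgebra {G : Type v} [Group G] [TopologicalSpace G]
    (η : G →* unitary 𝓜(ℂ, A)) : Prop :=
  (∀ (H : Type w) [NormedAddCommGroup H] [InnerProductSpace ℂ H] [CompleteSpace H]
      (π : A →⋆ₙₐ[ℂ] (H →L[ℂ] H)), IsNondegenerate π →
      ∃ ρ : 𝓜(ℂ, A) →⋆ₐ[ℂ] (H →L[ℂ] H), IsMultiplierExtension π ρ ∧
        ∀ v : H, Continuous fun g : G => ρ (η g : 𝓜(ℂ, A)) v) ∧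
  (∀ (H : Type w) [NormedAddCommGroup H] [InnerProductSpace ℂ H] [CompleteSpace H]
      (π₁ π₂ : A →⋆ₙₐ[ℂ] (H →L[ℂ] H)) (ρ₁ ρ₂ : 𝓜(ℂ, A) →⋆ₐ[ℂ] (H →L[ℂ] H)),
      IsNondegenerate π₁ → IsNondegenerate π₂ →
      IsMultiplierExtension π₁ ρ₁ → IsMultiplierExtension π₂ ρ₂ →
      (∀ g : G, ρ₁ (η g : 𝓜(ℂ, A)) = ρ₂ (η g : 𝓜(ℂ, A))) → π₁ = π₂)

/-- `φ` is a state of `A`. -/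
def IsState (φ : A →L[ℂ] ℂ) : Prop :=
  ‖φ‖ = 1 ∧ ∀ a : A, 0 ≤ (φ (star a * a)).re ∧ (φ (star a * a)).im = 0

/-- `ψ` is the canonical extension of the state `φ` of `A` to `M(A)`: writing
`φ(a) = ⟨π(a)v, v⟩` with a non-degenerate representation `π` and a unit vector `v`, it is
`ψ(m) = ⟨ρ(m)v, v⟩`, where `ρ` is the extension of `π` to `M(A)`. -/
def IsCanonicalExtension (φ : A →L[ℂ] ℂ) (ψ : 𝓜(ℂ, A) → ℂ) : Prop :=
  ∃ (H : Type u) (_ : NormedAddCommGroup H) (_ : InnerProductSpace ℂ H) (_ : CompleteSpace H)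
    (π : A →⋆ₙₐ[ℂ] (H →L[ℂ] H)) (ρ : 𝓜(ℂ, A) →⋆ₐ[ℂ] (H →L[ℂ] H)) (v : H),
    IsNondegenerate π ∧ IsMultiplierExtension π ρ ∧ ‖v‖ = 1 ∧
      (∀ a : A, φ a = inner ℂ v (π a v)) ∧ ∀ m : 𝓜(ℂ, A), ψ m = inner ℂ v (ρ m v)

variable {V : Type v} [AddCommGroup V] [Module ℝ V] [TopologicalSpace V]

/-- The multiplier action `η` on `A` of the Lie group `(V, +)` is strictly smooth: the elements of
`A` whose left and right orbit maps `x ↦ η(x) a` and `x ↦ a η(x)` are smooth form a dense set. -/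
def IsStrictlySmooth (η : Multiplicative V →* unitary 𝓜(ℂ, A)) : Prop :=
  Dense {a : A |
    SmoothOn (univ : Set V) (fun x : V => (η (Multiplicative.ofAdd x) : 𝓜(ℂ, A)).fst a) ∧
    SmoothOn (univ : Set V) (fun x : V => (η (Multiplicative.ofAdd x) : 𝓜(ℂ, A)).snd a)}

/-- The image of the momentum map `φ ↦ (1/i) d(φ̃ ∘ η)(0)`, defined on the states `φ` of `A` whose
canonical extension `φ̃` to `M(A)` yields a smooth function `φ̃ ∘ η` on `V`. -/
def momentumImage (η : Multiplicative V →* unitary 𝓜(ℂ, A)) : Set (WeakDual ℝ V) :=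
  {l | ∃ (φ : A →L[ℂ] ℂ) (ψ : 𝓜(ℂ, A) → ℂ), IsState φ ∧ IsCanonicalExtension φ ψ ∧
    SmoothOn (univ : Set V) (fun x : V => ψ (η (Multiplicative.ofAdd x) : 𝓜(ℂ, A))) ∧
    ∀ x : V, HasDirDeriv (fun x : V => ψ (η (Multiplicative.ofAdd x) : 𝓜(ℂ, A))) 0 x
      (Complex.I * (l x : ℂ))}

/-- The momentum set `I_η`: the weak-⋆ closure of the image of the momentum map. -/
def momentumSet (η : Multiplicative V →* unitary 𝓜(ℂ, A)) : Set (WeakDual ℝ V) :=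
  closure (momentumImage η)

end Host

/-! ## Unitary multipliers of `C₀(X)` -/

section Multipliers

variable {X : Type u} [TopologicalSpace X]

/-- Multiplication by `u ∈ C(X, 𝕋)` on `C₀(X)`. -/
noncomputable def circleMul (u : C(X, Circle)) : C₀(X, ℂ) →L[ℂ] C₀(X, ℂ) :=
  LinearMap.mkContinuous
    { toFun := fun g =>
        { toFun := fun x => (u x : ℂ) * g x
          continuous_toFun := by fun_prop
          zero_at_infty' := by
            rw [tendsto_zero_iff_norm_tendsto_zero]
            simpa [Circle.norm_coe] using (tendsto_zero_iff_norm_tendsto_zero.1 g.zero_at_infty') }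
      map_add' := fun g h => by ext x; simp [mul_add]
      map_smul' := fun c g => by ext x; simp [mul_left_comm] }
    1 (fun g => by
      rw [one_mul, ← ZeroAtInftyContinuousMap.norm_toBCF_eq_norm,
        BoundedContinuousFunction.norm_le (norm_nonneg _)]
      intro x
      have := g.toBCF.norm_coe_le_norm x
      rw [ZeroAtInftyContinuousMap.norm_toBCF_eq_norm] at this
      simpa [Circle.norm_coe] using this)

@[simp] theorem circleMul_apply (u : C(X, Circle)) (g : C₀(X, ℂ)) (x : X) :
    circleMul u g x = (u x : ℂ) * g x := rfl

/-- `u ∈ C(X, 𝕋)` as a multiplier of `C₀(X)`. -/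
noncomputable def circleMultiplier (u : C(X, Circle)) : 𝓜(ℂ, C₀(X, ℂ)) :=
  ⟨(circleMul u, circleMul u), fun g h => by ext x; simp [mul_left_comm, mul_assoc]⟩

/-- The canonical homomorphism `C(X, 𝕋) → U(M(C₀(X)))`, by multiplication operators (for a locally
compact Hausdorff space `X` it is the usual identification of the two groups). -/
noncomputable def circleMultiplierHom : C(X, Circle) →* unitary 𝓜(ℂ, C₀(X, ℂ)) where
  toFun u := ⟨circleMultiplier u, by
    have h1 : ∀ z : Circle, (starRingEnd ℂ) (z : ℂ) = (z : ℂ)⁻¹ := fun z => by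
      rw [← Circle.coe_inv_eq_conj, Circle.coe_inv]
    have h2 : star (circleMultiplier u) = circleMultiplier u⁻¹ := by
      refine DoubleCentralizer.ext ℂ _ _ _ (Prod.ext ?_ ?_) <;>
      · ext g x
        first
          | rw [DoubleCentralizer.star_fst]
          | rw [DoubleCentralizer.star_snd]
        simp [circleMultiplier, h1]
    rw [Unitary.mem_iff, h2]
    constructor <;>
    · refine DoubleCentralizer.ext ℂ _ _ _ (Prod.ext ?_ ?_) <;>
      · ext g x
        simp [circleMultiplier]⟩
  map_one' := by
    refine Subtype.ext (DoubleCentralizer.ext ℂ _ _ _ (Prod.ext ?_ ?_)) <;>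
    · ext g x
      simp [circleMultiplier]
  map_mul' u u' := by
    refine Subtype.ext (DoubleCentralizer.ext ℂ _ _ _ (Prod.ext ?_ ?_)) <;>
    · ext g x
      simp [circleMultiplier, mul_assoc, mul_left_comm]

end Multipliers

/-! ## The complexification of `V` and tubes -/

/-- The complexification `V_ℂ = V ⊕ iV` of a real locally convex space, with the product topology;
`(x, y)` stands for `x + iy`. -/
def Cplx (V : Type u) : Type u := V × V

namespace Cplx

variable {V : Type u}

/-- The real part. -/
def re (s : Cplx V) : V := Prod.fst s

/-- The imaginary part. -/
def im (s : Cplx V) : V := Prod.snd s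

/-- The element `x + iy`. -/
def mk (x y : V) : Cplx V := (x, y)

instance [TopologicalSpace V] : TopologicalSpace (Cplx V) :=
  inferInstanceAs (TopologicalSpace (V × V))

instance [AddCommGroup V] : AddCommGroup (Cplx V) := inferInstanceAs (AddCommGroup (V × V))

@[ext] theorem ext {s t : Cplx V} (h₁ : s.re = t.re) (h₂ : s.im = t.im) : s = t :=
  Prod.ext h₁ h₂

@[simp] theorem re_mk (x y : V) : (mk x y).re = x := rfl
@[simp] theorem im_mk (x y : V) : (mk x y).im = y := rfl

section

variable [AddCommGroup V]

@[simp] theorem re_add (s t : Cplx V) : (s + t).re = s.re + t.re := rfl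
@[simp] theorem im_add (s t : Cplx V) : (s + t).im = s.im + t.im := rfl
@[simp] theorem re_zero : (0 : Cplx V).re = 0 := rfl
@[simp] theorem im_zero : (0 : Cplx V).im = 0 := rfl

variable [Module ℝ V]

/-- `(a + ib)(x + iy) = (ax - by) + i(ay + bx)`. -/
instance : SMul ℂ (Cplx V) :=
  ⟨fun z s => mk (z.re • s.re - z.im • s.im) (z.re • s.im + z.im • s.re)⟩

@[simp] theorem re_smul (z : ℂ) (s : Cplx V) : (z • s).re = z.re • s.re - z.im • s.im := rfl
@[simp] theorem im_smul (z : ℂ) (s : Cplx V) : (z • s).im = z.re • s.im + z.im • s.re := rfl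

instance : Module ℂ (Cplx V) where
  one_smul s := by ext <;> simp
  mul_smul a b s := by ext <;> simp <;> module
  smul_zero a := by ext <;> simp
  smul_add a s t := by ext <;> simp <;> module
  add_smul a b s := by ext <;> simp <;> module
  zero_smul s := by ext <;> simp

/-- The involution `(x + iy)⋆ = -x + iy`. -/
def inv (s : Cplx V) : Cplx V := mk (-s.re) s.im

end

end Cplx

section Tube

variable {V : Type u} [AddCommGroup V] [Module ℝ V] [TopologicalSpace V]

/-- The complex linear extension of `f ∈ V'` to `V_ℂ`: `f(x + iy) = f(x) + i f(y)`. -/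
noncomputable def dualExt (f : WeakDual ℝ V) (s : Cplx V) : ℂ :=
  (f s.re : ℂ) + Complex.I * (f s.im : ℂ)

/-- `⟨C, v⟩ = {f(v) : f ∈ C}`. -/
def pairing (C : Set (WeakDual ℝ V)) (v : V) : Set ℝ := (fun f : WeakDual ℝ V => f v) '' C

/-- The cone `B(C) = {v : inf ⟨C, v⟩ > -∞}`. -/
def boundedCone (C : Set (WeakDual ℝ V)) : Set V := {v | BddBelow (pairing C v)}

/-- The support function `s_C(v) = -inf ⟨C, v⟩`, meaningful for `C ≠ ∅` and `v ∈ B(C)`. -/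
noncomputable def supportFn (C : Set (WeakDual ℝ V)) (v : V) : ℝ := -sInf (pairing C v)

/-- The tube `S = V + i B(C)⁰`, where `B(C)⁰` is the interior of `B(C)`. -/
def tube (C : Set (WeakDual ℝ V)) : Set (Cplx V) := {s | s.im ∈ interior (boundedCone C)}

/-- `α_C(x + iy) = exp(-inf ⟨C, y⟩)`. -/
noncomputable def alphaC (C : Set (WeakDual ℝ V)) (s : Cplx V) : ℝ :=
  Real.exp (-sInf (pairing C s.im))

/-- The character `f ↦ e^{if(x)}` of `x ∈ V` on `C`. -/
noncomputable def charHom (C : Set (WeakDual ℝ V)) : Multiplicative V →* C(C, Circle) where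
  toFun x :=
    { toFun := fun f => Circle.exp ((f : WeakDual ℝ V) x.toAdd)
      continuous_toFun := Circle.exp.continuous.comp
        ((WeakDual.eval_continuous x.toAdd).comp continuous_subtype_val) }
  map_one' := by ext f; simp
  map_mul' x y := by ext f; simp

/-- The homomorphism `η : V → C(C, 𝕋) = U(M(C₀(C)))`, `η(x)(f) = e^{if(x)}`. -/
noncomputable def etaV (C : Set (WeakDual ℝ V)) :
    Multiplicative V →* unitary 𝓜(ℂ, C₀(C, ℂ)) :=
  circleMultiplierHom.comp (charHom C)

end Tube

end HostTube

/-!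
The proof rests on one estimate. On the interior of the cone `B(C)` the support function is locally
bounded, so for `y` in this interior every set `{f ∈ C : f(y) ≤ r}` is uniformly bounded on a
neighbourhood of zero and hence, by the Banach–Alaoglu theorem, weak-⋆ compact. Consequently
`f ↦ f(y)` tends to infinity at infinity on `C`. This gives local compactness of `C`, and it makes
the exponentials `e^{i f(x + i y)}` elements of `C₀(C)`. For a direction `h` the factor `|f(h)|` is
dominated by a multiple of `f(y)` up to a constant, so difference quotients, which converge
pointwise on `C`, converge uniformly; this proves that `γ` is holomorphic
(`IsTubeSet.holomorphicOn_expC`).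

The exponentials separate points and are closed under products and conjugation, so their span is
dense in `C₀(C)` by the Stone–Weierstrass theorem (`IsTubeSet.dense_span_expC`), and the image of
`C⋆(S, α_C)` in `C₀(C)` is everything. For injectivity it suffices, by Gelfand theory for the
commutative C⋆-algebra generated by the image of a morphism, that every nonzero `α_C`-bounded holomorphic
character of the tube is of the form `s ↦ e^{i f(s)}` with `f ∈ C`: the logarithmic derivative of the
character yields a continuous functional `f`, and the bound by `α_C` together with the Hahn–Banach
separation theorem puts `f` into `C` (`IsTubeSet.exists_mem_of_character`).

In the host algebra property, continuity is a consequence of the norm continuity of the orbits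
`x ↦ η(x) γ(s) = γ(s + x)`. For injectivity, let `π₁` and `π₂` induce the same representation of `V`.
The operators `π₁(γ(z₁ + z)) π₂(γ(z₂)) - π₁(γ(z₁)) π₂(γ(z₂ + z))` vanish for `z ∈ V`, and they are
holomorphic and of exponential type along `z = x + i w y` for `w` in a right half-plane, so a
Phragmén–Lindelöf theorem makes them vanish for all `z` in the tube
(`IsTubeSet.rep_mul_eq_of_etaV_eq`). Since `γ` is multiplicative, `π₁` and `π₂` agree on its image.

Every point evaluation is a state whose momentum is the point, so `C` lies in the momentum set.
Conversely let `ξ` be a unit vector whose coefficient is smooth with momentum `l`. A second order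
estimate shows that its orbit is Lipschitz at the origin, so that the derivative of the coefficient
can be computed, up to a small error, at `π(a) ξ` for `a` in the span of the exponentials. There it
is the value of a positive functional at `f ↦ f(v) |a(f)|²`. If `f(v) ≥ c` on `C`, this yields
`l(v) ≥ c` (`IsTubeSet.le_of_mem_momentumImage`), and `C` is an intersection of such half spaces.
-/

/-! ### Michal–Bastiani calculus -/

namespace HostTube

section Calculus

variable {X : Type u} {X' : Type u} {Y : Type v} {Z : Type w}
  [AddCommGroup X] [Module ℝ X] [AddCommGroup X'] [Module ℝ X']
  [AddCommGroup Y] [Module ℝ Y] [TopologicalSpace Y]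
  [AddCommGroup Z] [Module ℝ Z] [TopologicalSpace Z]

theorem HasDirDeriv.add [ContinuousAdd Y] {f g : X → Y} {x h : X} {y z : Y}
    (hf : HasDirDeriv f x h y) (hg : HasDirDeriv g x h z) :
    HasDirDeriv (fun x => f x + g x) x h (y + z) := by
  refine (Tendsto.add hf hg).congr fun t => ?_
  rw [← smul_add, ← add_sub_add_comm]

theorem HasDirDeriv.clm_comp {f : X → Y} {x h : X} {y : Y} (hf : HasDirDeriv f x h y)
    (T : Y →L[ℝ] Z) : HasDirDeriv (fun x => T (f x)) x h (T y) :=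
  ((T.continuous.tendsto y).comp hf).congr fun t => by simp

theorem HasDirDeriv.tendsto_line [ContinuousAdd Y] [ContinuousSMul ℝ Y]
    {f : X → Y} {x h : X} {y : Y} (hf : HasDirDeriv f x h y) :
    Tendsto (fun t : ℝ => f (x + t • h)) (𝓝[≠] 0) (𝓝 (f x)) := by
  have h0 : Tendsto (fun t : ℝ => t) (𝓝[≠] 0) (𝓝 0) := nhdsWithin_le_nhds
  have := (h0.smul hf).add_const (f x)
  rw [zero_smul, zero_add] at this
  refine this.congr' ?_
  filter_upwards [self_mem_nhdsWithin] with t ht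
  rw [smul_inv_smul₀ ht, sub_add_cancel]

/-- The chain rule for an affine inner map `x ↦ L x + c`. -/
theorem HasDirDeriv.comp_affine [TopologicalSpace X] [TopologicalSpace X']
    {f : X → Y} {x h : X'} {y : Y} {L : X' →L[ℝ] X} {c : X}
    (hf : HasDirDeriv f (L x + c) (L h) y) : HasDirDeriv (fun x => f (L x + c)) x h y := by
  refine Tendsto.congr (fun t => ?_) hf
  simp only [map_add, map_smul]
  rw [add_right_comm]

theorem IsCn.continuousOn [TopologicalSpace X] {n : ℕ} {U : Set X} {f : X → Y} (hf : IsCn n U f) :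
    ContinuousOn f U := by
  cases n with
  | zero => exact hf
  | succ n => exact hf.1

theorem IsCn.of_succ {n : ℕ} {X : Type u} [AddCommGroup X] [Module ℝ X] [TopologicalSpace X]
    {U : Set X} {f : X → Y} (hf : IsCn (n + 1) U f) : IsCn n U f := by
  induction n generalizing X with
  | zero => exact hf.continuousOn
  | succ n ih =>
    obtain ⟨hc, df, hd, hdf⟩ := hf
    exact ⟨hc, df, hd, ih hdf⟩

theorem IsCn.add [ContinuousAdd Y] {n : ℕ} {X : Type u} [AddCommGroup X] [Module ℝ X]
    [TopologicalSpace X] {U : Set X} {f g : X → Y} (hf : IsCn n U f) (hg : IsCn n U g) :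
    IsCn n U (fun x => f x + g x) := by
  induction n generalizing X with
  | zero => exact ContinuousOn.add hf hg
  | succ n ih =>
    obtain ⟨hc, df, hd, hdf⟩ := hf
    obtain ⟨hc', dg, hd', hdg⟩ := hg
    exact ⟨hc.add hc', fun p => df p + dg p, fun x hx h => (hd x hx h).add (hd' x hx h),
      ih hdf hdg⟩

theorem IsCn.clm_comp {n : ℕ} {X : Type u} [AddCommGroup X] [Module ℝ X]
    [TopologicalSpace X] {U : Set X} {f : X → Y} (hf : IsCn n U f) (T : Y →L[ℝ] Z) :
    IsCn n U (fun x => T (f x)) := by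
  induction n generalizing X with
  | zero => exact T.continuous.comp_continuousOn hf
  | succ n ih =>
    obtain ⟨hc, df, hd, hdf⟩ := hf
    exact ⟨T.continuous.comp_continuousOn hc, fun p => T (df p),
      fun x hx h => (hd x hx h).clm_comp T, ih hdf⟩

theorem IsCn.comp_affine {n : ℕ} {X X' : Type u} [AddCommGroup X] [Module ℝ X]
    [TopologicalSpace X] [ContinuousAdd X] [AddCommGroup X'] [Module ℝ X'] [TopologicalSpace X']
    {U : Set X} {U' : Set X'} {f : X → Y} (hf : IsCn n U f) (L : X' →L[ℝ] X) (c : X)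
    (hU : MapsTo (fun x => L x + c) U' U) : IsCn n U' (fun x => f (L x + c)) := by
  induction n generalizing X X' with
  | zero => exact ContinuousOn.comp hf (L.continuous.add continuous_const).continuousOn hU
  | succ n ih =>
    obtain ⟨hc, df, hd, hdf⟩ := hf
    refine ⟨hc.comp (L.continuous.add continuous_const).continuousOn hU,
      fun p => df (L p.1 + c, L p.2), fun x hx h => (hd _ (hU hx) _).comp_affine, ?_⟩
    have := ih hdf (L.prodMap L) (c, 0) (U' := U' ×ˢ univ) fun p hp => by
      simpa using hU hp.1
    simpa [Prod.map] using this

theorem hasDirDeriv_clm [TopologicalSpace X] (T : X →L[ℝ] Y) (x h : X) :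
    HasDirDeriv (fun x => T x) x h (T h) := by
  refine tendsto_const_nhds.congr' ?_
  filter_upwards [self_mem_nhdsWithin] with t ht
  rw [map_add, add_sub_cancel_left, map_smul, inv_smul_smul₀ ht]

theorem isCn_clm {n : ℕ} {X : Type u} [AddCommGroup X] [Module ℝ X]
    [TopologicalSpace X] (U : Set X) (T : X →L[ℝ] Y) : IsCn n U (fun x => T x) := by
  induction n generalizing X with
  | zero => exact T.continuous.continuousOn
  | succ n ih =>
    exact ⟨T.continuous.continuousOn, fun p => T p.2, fun x _ h => hasDirDeriv_clm T x h,
      ih _ (T.comp (ContinuousLinearMap.snd ℝ X X))⟩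

end Calculus

section Product

variable {X : Type u} {Y : Type v} [AddCommGroup X] [Module ℝ X]
  [NonUnitalRing Y] [Module ℝ Y] [IsScalarTower ℝ Y Y] [SMulCommClass ℝ Y Y]
  [TopologicalSpace Y] [IsTopologicalRing Y] [ContinuousSMul ℝ Y]

theorem HasDirDeriv.mul {f g : X → Y} {x h : X} {y z : Y}
    (hf : HasDirDeriv f x h y) (hg : HasDirDeriv g x h z) :
    HasDirDeriv (fun x => f x * g x) x h (y * g x + f x * z) := by
  refine ((Tendsto.mul hf hg.tendsto_line).add (Tendsto.mul tendsto_const_nhds hg)).congr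
    fun t => ?_
  rw [smul_mul_assoc, mul_smul_comm, ← smul_add]
  congr 1
  noncomm_ring

theorem IsCn.mul {n : ℕ} {X : Type u} [AddCommGroup X] [Module ℝ X]
    [TopologicalSpace X] [ContinuousAdd X] {U : Set X} {f g : X → Y}
    (hf : IsCn n U f) (hg : IsCn n U g) : IsCn n U (fun x => f x * g x) := by
  induction n generalizing X with
  | zero => exact ContinuousOn.mul hf hg
  | succ n ih =>
    have hf' := hf.of_succ
    have hg' := hg.of_succ
    obtain ⟨hc, df, hd, hdf⟩ := hf
    obtain ⟨hc', dg, hd', hdg⟩ := hg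
    have lift : ∀ {k : X → Y}, IsCn n U k → IsCn n (U ×ˢ (univ : Set X)) (fun p => k p.1) := by
      intro k hk
      have := hk.comp_affine (ContinuousLinearMap.fst ℝ X X) 0 (U' := U ×ˢ univ)
        fun p hp => by simpa using hp.1
      simpa using this
    exact ⟨hc.mul hc', fun p => df p * g p.1 + f p.1 * dg p,
      fun x hx h => (hd x hx h).mul (hd' x hx h),
      (ih hdf (lift hg')).add (ih (lift hf') hdg)⟩

end Product

section ZeroAtInfty

variable {K : Type u} [TopologicalSpace K]

theorem norm_le_of_forall_norm_le {g : C₀(K, ℂ)} {r : ℝ} (hr : 0 ≤ r) (h : ∀ f, ‖g f‖ ≤ r) :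
    ‖g‖ ≤ r := by
  rw [← ZeroAtInftyContinuousMap.norm_toBCF_eq_norm]
  exact (BoundedContinuousFunction.norm_le hr).2 h

theorem norm_apply_le_norm (g : C₀(K, ℂ)) (f : K) : ‖g f‖ ≤ ‖g‖ := by
  rw [← ZeroAtInftyContinuousMap.norm_toBCF_eq_norm]
  exact g.toBCF.norm_coe_le_norm f

/-- A curve in `C₀(K)` that is differentiable at each point of `K`, with derivatives given by a
curve continuous for the sup norm, is differentiable for the sup norm: the pointwise mean value
inequality is uniform on `K`. The parameter is real or complex. -/
theorem hasDerivAt_of_pointwise {𝕜 : Type v} [RCLike 𝕜] [NormedSpace 𝕜 ℂ]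
    {G G' : 𝕜 → C₀(K, ℂ)} {w : 𝕜}
    (hd : ∀ᶠ z in 𝓝 w, ∀ f, HasDerivAt (fun z => G z f) (G' z f) z)
    (hc : ContinuousAt G' w) : HasDerivAt G (G' w) w := by
  rw [hasDerivAt_iff_isLittleO, Asymptotics.isLittleO_iff]
  intro ε hε
  have h2 : ∀ᶠ z in 𝓝 w, ‖G' z - G' w‖ < ε := by
    simpa [dist_eq_norm] using hc.eventually (Metric.ball_mem_nhds _ hε)
  obtain ⟨r, hr, hball⟩ := Metric.eventually_nhds_iff_ball.1 (hd.and h2)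
  filter_upwards [Metric.ball_mem_nhds w hr] with z hz
  refine norm_le_of_forall_norm_le (by positivity) fun f => ?_
  have key := (convex_ball w r).norm_image_sub_le_of_norm_hasDerivWithin_le
    (f := fun z => G z f - z • G' w f) (f' := fun z => G' z f - G' w f) (C := ε) (x := w) (y := z)
    (fun x hx => by
      have h1 := (hball x hx).1 f
      have h3 : HasDerivAt (fun z : 𝕜 => z • G' w f) (G' w f) x := by
        simpa using (hasDerivAt_id x).smul_const (G' w f)
      exact (h1.sub h3).hasDerivWithinAt)
    (fun x hx => (norm_apply_le_norm (G' x - G' w) f).trans (hball x hx).2.le)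
    (Metric.mem_ball_self hr) hz
  have e : (G z - G w - (z - w) • G' w) f = G z f - z • G' w f - (G w f - w • G' w f) := by
    simp only [ZeroAtInftyContinuousMap.sub_apply, ZeroAtInftyContinuousMap.smul_apply, sub_smul]
    abel
  rw [e]
  exact key

/-- The version of `hasDerivAt_of_pointwise` for directional derivatives. -/
theorem hasDirDeriv_of_pointwise {X : Type v} [AddCommGroup X] [Module ℝ X]
    {F : X → C₀(K, ℂ)} {x h : X} {F' : ℝ → C₀(K, ℂ)}
    (hd : ∀ᶠ t : ℝ in 𝓝 0, ∀ f, HasDerivAt (fun t : ℝ => F (x + t • h) f) (F' t f) t)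
    (hc : ContinuousAt F' 0) : HasDirDeriv F x h (F' 0) := by
  have := hasDerivAt_of_pointwise hd hc
  rw [hasDerivAt_iff_tendsto_slope_zero] at this
  simpa [HasDirDeriv] using this

end ZeroAtInfty

end HostTube

/-! ### The cone `B(C)` and compactness in `C` -/

namespace HostTube

section Geometry

variable {V : Type u} [AddCommGroup V] [Module ℝ V] [TopologicalSpace V]
  {C : Set (WeakDual ℝ V)}

theorem sInf_pairing_le {y : V} (hy : y ∈ boundedCone C) {f : WeakDual ℝ V} (hf : f ∈ C) :
    sInf (pairing C y) ≤ f y :=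
  csInf_le hy ⟨f, hf, rfl⟩

theorem le_sInf_pairing (hne : C.Nonempty) {y : V} {r : ℝ}
    (h : ∀ f ∈ C, r ≤ f y) : r ≤ sInf (pairing C y) :=
  le_csInf (hne.image _) (by rintro _ ⟨f, hf, rfl⟩; exact h f hf)

theorem mem_boundedCone_of_le {y : V} {r : ℝ} (h : ∀ f ∈ C, r ≤ f y) : y ∈ boundedCone C :=
  ⟨r, by rintro _ ⟨f, hf, rfl⟩; exact h f hf⟩

theorem add_mem_boundedCone {y z : V} (hy : y ∈ boundedCone C) (hz : z ∈ boundedCone C) :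
    y + z ∈ boundedCone C :=
  mem_boundedCone_of_le fun f hf => by
    rw [map_add]
    exact add_le_add (sInf_pairing_le hy hf) (sInf_pairing_le hz hf)

theorem smul_mem_boundedCone {y : V} (hy : y ∈ boundedCone C) {t : ℝ} (ht : 0 ≤ t) :
    t • y ∈ boundedCone C :=
  mem_boundedCone_of_le fun f hf => by
    rw [map_smul, smul_eq_mul]
    exact mul_le_mul_of_nonneg_left (sInf_pairing_le hy hf) ht

theorem sInf_pairing_add_le (hne : C.Nonempty) {y z : V} (hy : y ∈ boundedCone C)
    (hz : z ∈ boundedCone C) :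
    sInf (pairing C y) + sInf (pairing C z) ≤ sInf (pairing C (y + z)) :=
  le_sInf_pairing hne fun f hf => by
    rw [map_add]
    exact add_le_add (sInf_pairing_le hy hf) (sInf_pairing_le hz hf)

theorem mul_sInf_pairing_le (hne : C.Nonempty) {y : V} (hy : y ∈ boundedCone C) {t : ℝ}
    (ht : 0 ≤ t) : t * sInf (pairing C y) ≤ sInf (pairing C (t • y)) :=
  le_sInf_pairing hne fun f hf => by
    rw [map_smul, smul_eq_mul]
    exact mul_le_mul_of_nonneg_left (sInf_pairing_le hy hf) ht

/-- Hahn–Banach in the weak-⋆ topology, whose continuous functionals are the evaluations. -/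
theorem exists_forall_le_of_notMem (hclosed : IsClosed C) (hconv : Convex ℝ C)
    {l : WeakDual ℝ V} (hl : l ∉ C) : ∃ (v : V) (c : ℝ), l v < c ∧ ∀ f ∈ C, c ≤ f v := by
  have : LocallyConvexSpace ℝ (WeakDual ℝ V) :=
    inferInstanceAs (LocallyConvexSpace ℝ (WeakBilin (topDualPairing ℝ V)))
  obtain ⟨F, c, h1, h2⟩ := geometric_hahn_banach_point_closed hconv hclosed hl
  obtain ⟨v, hv⟩ := LinearMap.dualEmbedding_surjective (topDualPairing ℝ V) F
  have hv' : ∀ f : WeakDual ℝ V, F f = f v := fun f => by rw [← hv]; rfl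
  exact ⟨v, c, by rwa [← hv'], fun f hf => by rw [← hv']; exact (h2 f hf).le⟩

theorem smul_mem_interior_boundedCone [ContinuousSMul ℝ V] {y : V}
    (hy : y ∈ interior (boundedCone C)) {t : ℝ} (ht : 0 < t) : t • y ∈ interior (boundedCone C) := by
  rw [mem_interior_iff_mem_nhds] at hy ⊢
  have : Tendsto (fun x : V => t⁻¹ • x) (𝓝 (t • y)) (𝓝 y) := by
    simpa [inv_smul_smul₀ ht.ne'] using (continuous_const_smul t⁻¹).tendsto (t • y)
  filter_upwards [this hy] with x hx
  simpa [smul_inv_smul₀ ht.ne'] using smul_mem_boundedCone hx ht.le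

/-- A neighbourhood of `0` absorbs every vector. -/
theorem exists_pos_smul_mem [ContinuousSMul ℝ V] {W : Set V} (hW : W ∈ 𝓝 (0 : V)) (h : V) :
    ∃ t : ℝ, 0 < t ∧ t • h ∈ W := by
  have : Tendsto (fun t : ℝ => t • h) (𝓝[>] 0) (𝓝 0) := by
    have hc : Continuous fun t : ℝ => t • h := by fun_prop
    simpa using (hc.tendsto 0).mono_left nhdsWithin_le_nhds
  obtain ⟨t, h1, h2⟩ := ((this.eventually hW).and self_mem_nhdsWithin).exists
  exact ⟨t, h2, h1⟩

variable [IsTopologicalAddGroup V]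

theorem add_mem_interior_boundedCone {y z : V} (hy : y ∈ interior (boundedCone C))
    (hz : z ∈ boundedCone C) : y + z ∈ interior (boundedCone C) := by
  rw [mem_interior_iff_mem_nhds] at hy ⊢
  have : Tendsto (fun x : V => x - z) (𝓝 (y + z)) (𝓝 y) := by
    simpa using (continuous_sub_right z).tendsto (y + z)
  filter_upwards [this hy] with x hx
  simpa using add_mem_boundedCone hx hz

/-- Equicontinuity of `C` relative to the value at an interior point `y` of `B(C)`: apply the
local bound for `s_C` to `y + u` and `y - u`. -/
theorem exists_forall_abs_le (hbdd : LocallyBoundedOn (interior (boundedCone C)) (supportFn C))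
    {y : V} (hy : y ∈ interior (boundedCone C)) :
    ∃ W ∈ 𝓝 (0 : V), ∃ M : ℝ, ∀ u ∈ W, ∀ f ∈ C, |f u| ≤ M + f y := by
  obtain ⟨U, hU, M, hM⟩ := hbdd y hy
  rw [isOpen_interior.nhdsWithin_eq hy] at hU
  have h1 : Tendsto (fun u : V => y + u) (𝓝 0) (𝓝 y) := by
    simpa using (continuous_const_add y).tendsto (0 : V)
  have h2 : Tendsto (fun u : V => y - u) (𝓝 0) (𝓝 y) := by
    simpa using (continuous_sub_left y).tendsto (0 : V)
  have hU' := inter_mem hU (isOpen_interior.mem_nhds hy)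
  refine ⟨_, inter_mem (h1 hU') (h2 hU'), M, fun u hu f hf => ?_⟩
  have key : ∀ z ∈ U ∩ interior (boundedCone C), -M ≤ f z := fun z hz => by
    have h3 := (abs_le.1 (hM z hz.1)).2
    have h4 := sInf_pairing_le (interior_subset hz.2) hf
    unfold supportFn at h3
    linarith
  have h5 := key _ hu.1
  have h6 := key _ hu.2
  rw [map_add] at h5
  rw [map_sub] at h6
  exact abs_le.2 ⟨by linarith, by linarith⟩

variable [ContinuousSMul ℝ V]

/-- The relative form of `exists_forall_abs_le` for a single vector. -/
theorem exists_abs_le_mul (hbdd : LocallyBoundedOn (interior (boundedCone C)) (supportFn C))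
    {y : V} (hy : y ∈ interior (boundedCone C)) (h : V) :
    ∃ R M : ℝ, 0 ≤ R ∧ ∀ f ∈ C, |f h| ≤ R * (M + f y) := by
  obtain ⟨W, hW, M, hM⟩ := exists_forall_abs_le hbdd hy
  obtain ⟨t, ht, htW⟩ := exists_pos_smul_mem hW h
  refine ⟨t⁻¹, M, by positivity, fun f hf => ?_⟩
  have := hM _ htW f hf
  rw [map_smul, smul_eq_mul, abs_mul, abs_of_pos ht] at this
  rw [inv_mul_eq_div, le_div_iff₀ ht]
  linarith

theorem exists_mem_interior_ne (hint : (interior (boundedCone C)).Nonempty)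
    {f g : WeakDual ℝ V} (hfg : f ≠ g) : ∃ y ∈ interior (boundedCone C), f y ≠ g y := by
  obtain ⟨y, hy⟩ := hint
  by_contra! H
  refine hfg (DFunLike.ext _ _ fun v => ?_)
  have hW : (fun u : V => y + u) ⁻¹' interior (boundedCone C) ∈ 𝓝 (0 : V) :=
    ((isOpen_interior.preimage (continuous_const.add continuous_id)).mem_nhds (by simpa using hy))
  obtain ⟨t, ht, htW⟩ := exists_pos_smul_mem hW v
  have h1 := H _ htW
  rw [map_add, map_add, H y hy, map_smul, map_smul] at h1
  exact smul_right_injective ℝ ht.ne' (add_left_cancel h1)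

/-- The Banach–Alaoglu argument: the sublevel set is pointwise bounded and equicontinuous, so it is
compact for pointwise convergence. -/
theorem isCompact_sublevel (hclosed : IsClosed C)
    (hbdd : LocallyBoundedOn (interior (boundedCone C)) (supportFn C))
    {y : V} (hy : y ∈ interior (boundedCone C)) (R : ℝ) :
    IsCompact {f : WeakDual ℝ V | f ∈ C ∧ f y ≤ R} := by
  set K := {f : WeakDual ℝ V | f ∈ C ∧ f y ≤ R}
  have hK : IsClosed K :=
    hclosed.inter (isClosed_le (WeakDual.eval_continuous y) continuous_const)
  have hind : IsInducing (fun (f : WeakDual ℝ V) (v : V) => f v) := ⟨rfl⟩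
  rw [hind.isCompact_iff]
  have hcpt : ∀ v : V, ∃ r : ℝ, ∀ f ∈ K, f v ∈ Icc (-r) r := fun v => by
    obtain ⟨Q, M, hQ, h⟩ := exists_abs_le_mul hbdd hy v
    refine ⟨Q * (M + R), fun f hf => abs_le.1 ((h f hf.1).trans ?_)⟩
    exact mul_le_mul_of_nonneg_left (by linarith [hf.2]) hQ
  choose r hr using hcpt
  refine (isCompact_univ_pi fun v => isCompact_Icc (a := -r v) (b := r v)).of_isClosed_subset
    ?_ (by rintro _ ⟨f, hf, rfl⟩ v -; exact hr v f hf)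
  refine isClosed_of_closure_subset fun g hg => ?_
  have hlin : g ∈ range ((↑) : (V →ₗ[ℝ] ℝ) → V → ℝ) := by
    refine closure_minimal ?_ (LinearMap.isClosed_range_coe V ℝ (RingHom.id ℝ)) hg
    rintro _ ⟨f, -, rfl⟩
    exact ⟨f.toLinearMap, rfl⟩
  obtain ⟨g, rfl⟩ := hlin
  obtain ⟨W, hW, M, hM⟩ := exists_forall_abs_le hbdd hy
  have hgW : ∀ u ∈ W, |g u| ≤ M + R := fun u hu => by
    have hcl : IsClosed {k : V → ℝ | |k u| ≤ M + R} :=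
      isClosed_le (continuous_apply u).abs continuous_const
    refine closure_minimal ?_ hcl hg
    rintro _ ⟨f, hf, rfl⟩
    exact (hM u hu f hf.1).trans (by linarith [hf.2])
  let g' : WeakDual ℝ V := g.clmOfExistsBoundedImage ⟨W, hW,
    (NormedSpace.isVonNBounded_iff' ℝ).2 ⟨M + R, by rintro _ ⟨u, hu, rfl⟩; exact hgW u hu⟩⟩
  refine ⟨g', ?_, rfl⟩
  rw [← hK.closure_eq, hind.closure_eq_preimage_closure_image]
  exact hg

theorem tendsto_eval_cocompact (hclosed : IsClosed C)
    (hbdd : LocallyBoundedOn (interior (boundedCone C)) (supportFn C))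
    {y : V} (hy : y ∈ interior (boundedCone C)) :
    Tendsto (fun f : C => (f : WeakDual ℝ V) y) (cocompact C) atTop := by
  refine tendsto_atTop.2 fun R => ?_
  have h := isCompact_sublevel hclosed hbdd hy R
  have h' : IsCompact ((↑) ⁻¹' {f : WeakDual ℝ V | f ∈ C ∧ f y ≤ R} : Set C) :=
    hclosed.isClosedEmbedding_subtypeVal.isCompact_preimage h
  filter_upwards [h'.compl_mem_cocompact] with f hf
  by_contra hlt
  exact hf ⟨f.2, (not_le.1 hlt).le⟩

theorem locallyCompactSpace_of_interior_nonempty (hclosed : IsClosed C)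
    (hbdd : LocallyBoundedOn (interior (boundedCone C)) (supportFn C))
    (hint : (interior (boundedCone C)).Nonempty) : LocallyCompactSpace C := by
  obtain ⟨y, hy⟩ := hint
  have : WeaklyLocallyCompactSpace C := ⟨fun f => by
    refine ⟨_, hclosed.isClosedEmbedding_subtypeVal.isCompact_preimage
      (isCompact_sublevel hclosed hbdd hy ((f : WeakDual ℝ V) y + 1)), ?_⟩
    have hc : Continuous fun g : C => (g : WeakDual ℝ V) y :=
      (WeakDual.eval_continuous y).comp continuous_subtype_val
    filter_upwards [hc.continuousAt.eventually (gt_mem_nhds (lt_add_one _))] with g hg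
    exact ⟨g.2, le_of_lt hg⟩⟩
  infer_instance

/-- `C` is cut out by the inequalities `f y ≥ inf ⟨C, y⟩` for `y` in the interior of `B(C)`: a
separating vector `v` may be replaced by `v + ε y₀` with `y₀` interior. -/
theorem mem_of_forall_interior_le (hne : C.Nonempty) (hclosed : IsClosed C) (hconv : Convex ℝ C)
    (hint : (interior (boundedCone C)).Nonempty) {l : WeakDual ℝ V}
    (h : ∀ y ∈ interior (boundedCone C), sInf (pairing C y) ≤ l y) : l ∈ C := by
  by_contra hl
  obtain ⟨v, c, h1, h2⟩ := exists_forall_le_of_notMem hclosed hconv hl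
  obtain ⟨y, hy⟩ := hint
  have hv : v ∈ boundedCone C := mem_boundedCone_of_le h2
  have key : ∀ ε : ℝ, 0 < ε → c + ε * sInf (pairing C y) ≤ l v + ε * l y := fun ε hε => by
    have hy' := smul_mem_interior_boundedCone hy hε
    have h3 := h _ (add_mem_interior_boundedCone hy' hv)
    have h4 := sInf_pairing_add_le hne (interior_subset hy') hv
    have h5 := mul_sInf_pairing_le hne (interior_subset hy) hε.le
    have h6 := le_sInf_pairing hne h2
    rw [map_add, map_smul, smul_eq_mul] at h3
    linarith
  have lim : ∀ a b : ℝ, Tendsto (fun ε : ℝ => a + ε * b) (𝓝[>] 0) (𝓝 a) := fun a b => by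
    have : Continuous fun ε : ℝ => a + ε * b := by fun_prop
    simpa using (this.tendsto 0).mono_left nhdsWithin_le_nhds
  have := le_of_tendsto_of_tendsto (lim c _) (lim (l v) _)
    (eventually_nhdsWithin_of_forall fun ε hε => key ε hε)
  linarith

end Geometry

end HostTube

/-! ### The exponential family in `C₀(C)` -/

namespace HostTube

section CplxTopology

variable {V : Type u}

namespace Cplx

theorem continuous_re [TopologicalSpace V] : Continuous (re : Cplx V → V) := continuous_fst

theorem continuous_im [TopologicalSpace V] : Continuous (im : Cplx V → V) := continuous_snd

variable [AddCommGroup V]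

instance [TopologicalSpace V] [IsTopologicalAddGroup V] : IsTopologicalAddGroup (Cplx V) :=
  inferInstanceAs (IsTopologicalAddGroup (V × V))

@[simp] theorem re_inv (s : Cplx V) : s.inv.re = -s.re := rfl
@[simp] theorem im_inv (s : Cplx V) : s.inv.im = s.im := rfl

variable [Module ℝ V]

@[simp] theorem re_real_smul (r : ℝ) (s : Cplx V) : (r • s).re = r • s.re :=
  (re_smul (r : ℂ) s).trans (by simp)

@[simp] theorem im_real_smul (r : ℝ) (s : Cplx V) : (r • s).im = r • s.im :=
  (im_smul (r : ℂ) s).trans (by simp)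

instance [TopologicalSpace V] [ContinuousSMul ℝ V] : ContinuousSMul ℝ (Cplx V) where
  continuous_smul := by
    have h : Continuous fun p : ℝ × Cplx V => ((p.1 • p.2.re, p.1 • p.2.im) : V × V) :=
      (continuous_fst.smul (continuous_re.comp continuous_snd)).prodMk
        (continuous_fst.smul (continuous_im.comp continuous_snd))
    exact h.congr fun p => Cplx.ext (re_real_smul p.1 p.2).symm (im_real_smul p.1 p.2).symm

end Cplx

variable [AddCommGroup V] [Module ℝ V]

theorem half_add_half (s : Cplx V) : (2⁻¹ : ℝ) • s + (2⁻¹ : ℝ) • s = s := by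
  rw [← add_smul]; norm_num

variable [TopologicalSpace V]

theorem dualExt_add (f : WeakDual ℝ V) (s t : Cplx V) :
    dualExt f (s + t) = dualExt f s + dualExt f t := by
  simp only [dualExt, Cplx.re_add, Cplx.im_add, map_add, Complex.ofReal_add]
  ring

theorem dualExt_smul (f : WeakDual ℝ V) (z : ℂ) (s : Cplx V) :
    dualExt f (z • s) = z * dualExt f s := by
  simp only [dualExt, Cplx.re_smul, Cplx.im_smul, map_add, map_sub, map_smul, smul_eq_mul]
  apply Complex.ext <;> simp

theorem dualExt_real_smul (f : WeakDual ℝ V) (r : ℝ) (s : Cplx V) :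
    dualExt f (r • s) = r * dualExt f s := by
  rw [← Complex.coe_smul, dualExt_smul]

theorem norm_exp_dualExt (f : WeakDual ℝ V) (s : Cplx V) :
    ‖Complex.exp (Complex.I * dualExt f s)‖ = Real.exp (-f s.im) := by
  rw [Complex.norm_exp]
  simp [dualExt]

theorem norm_dualExt_le (f : WeakDual ℝ V) (s : Cplx V) :
    ‖dualExt f s‖ ≤ |f s.re| + |f s.im| := by
  refine (norm_add_le _ _).trans ?_
  simp

theorem continuous_dualExt (C : Set (WeakDual ℝ V)) (s : Cplx V) :
    Continuous fun f : C => dualExt (f : WeakDual ℝ V) s := by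
  have h : ∀ v : V, Continuous fun f : C => (f : WeakDual ℝ V) v := fun v =>
    (WeakDual.eval_continuous v).comp continuous_subtype_val
  exact (Complex.continuous_ofReal.comp (h _)).add
    (continuous_const.mul (Complex.continuous_ofReal.comp (h _)))

end CplxTopology

section MkC0

variable {K : Type u} [TopologicalSpace K]

open Classical in
/-- The function `g` as an element of `C₀(K)`, with the value `0` when `g` is not continuous or does
not vanish at infinity. -/
noncomputable def mkC0 (g : K → ℂ) : C₀(K, ℂ) :=
  if h : Continuous g ∧ Tendsto g (cocompact K) (𝓝 0) then ⟨⟨g, h.1⟩, h.2⟩ else 0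

theorem mkC0_apply {g : K → ℂ} (h₁ : Continuous g) (h₂ : Tendsto g (cocompact K) (𝓝 0)) (f : K) :
    mkC0 g f = g f := by
  rw [mkC0, dif_pos ⟨h₁, h₂⟩]
  rfl

end MkC0

section Exponential

variable {V : Type u} [AddCommGroup V] [Module ℝ V] [TopologicalSpace V]

/-- The element `f ↦ exp(i f(s))` of `C₀(C)`, for `s` in the tube of `C`. -/
noncomputable def expC (C : Set (WeakDual ℝ V)) (s : Cplx V) : C₀(C, ℂ) :=
  mkC0 fun f : C => Complex.exp (Complex.I * dualExt (f : WeakDual ℝ V) s)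

/-- The element `f ↦ exp(i f(s)) f(h)` of `C₀(C)`, for `s` in the tube of `C` and any `h`. Up to the
factor `i` it is the derivative of `expC C` at `s` in the direction `h`. -/
noncomputable def expLinC (C : Set (WeakDual ℝ V)) (s h : Cplx V) : C₀(C, ℂ) :=
  mkC0 fun f : C => Complex.exp (Complex.I * dualExt (f : WeakDual ℝ V) s) *
    dualExt (f : WeakDual ℝ V) h

variable {C : Set (WeakDual ℝ V)}

theorem isOpen_tube : IsOpen (tube C) := isOpen_interior.preimage Cplx.continuous_im

theorem smul_mem_tube [ContinuousSMul ℝ V] {s : Cplx V} (hs : s ∈ tube C) {t : ℝ} (ht : 0 < t) :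
    t • s ∈ tube C := by
  show (t • s).im ∈ interior (boundedCone C)
  rw [Cplx.im_real_smul]
  exact smul_mem_interior_boundedCone hs ht

theorem half_mem_tube [ContinuousSMul ℝ V] {s : Cplx V} (hs : s ∈ tube C) :
    (2⁻¹ : ℝ) • s ∈ tube C :=
  smul_mem_tube hs (by norm_num)

variable [IsTopologicalAddGroup V]

theorem add_mem_tube {s t : Cplx V} (hs : s ∈ tube C) (ht : t.im ∈ boundedCone C) :
    s + t ∈ tube C := add_mem_interior_boundedCone hs ht

variable [ContinuousSMul ℝ V]

/-- Equicontinuity of `C` on the complexification, relative to a point of the tube. -/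
theorem exists_forall_norm_dualExt_le
    (hbdd : LocallyBoundedOn (interior (boundedCone C)) (supportFn C))
    {s : Cplx V} (hs : s ∈ tube C) :
    ∃ M : ℝ, (∀ f ∈ C, 0 ≤ M + f s.im) ∧ ∀ ε : ℝ, 0 < ε → ∀ᶠ h : Cplx V in 𝓝 0, ∀ f ∈ C,
      ‖dualExt f h‖ ≤ ε * (M + f s.im) := by
  obtain ⟨W, hW, M, hM⟩ := exists_forall_abs_le hbdd hs
  refine ⟨M, fun f hf => by simpa using hM 0 (mem_of_mem_nhds hW) f hf, fun ε hε => ?_⟩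
  have key : ∀ r : Cplx V → V, Continuous r → r 0 = 0 →
      ∀ᶠ h in 𝓝 (0 : Cplx V), (2 * ε⁻¹) • r h ∈ W := fun r hr h0 => by
    have : Tendsto (fun h => (2 * ε⁻¹) • r h) (𝓝 (0 : Cplx V)) (𝓝 0) := by
      have hc : Continuous fun h => (2 * ε⁻¹) • r h := hr.const_smul _
      simpa [h0] using hc.tendsto 0
    exact this hW
  filter_upwards [key _ Cplx.continuous_re rfl, key _ Cplx.continuous_im rfl] with h h1 h2 f hf
  have e : ∀ v : V, (2 * ε⁻¹) • v ∈ W → |f v| ≤ ε / 2 * (M + f s.im) := fun v hv => by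
    have := hM _ hv f hf
    rw [map_smul, smul_eq_mul, abs_mul, abs_of_pos (by positivity : 0 < 2 * ε⁻¹)] at this
    calc |f v| = ε / 2 * (2 * ε⁻¹ * |f v|) := by field_simp
      _ ≤ _ := by gcongr
  linarith [norm_dualExt_le f h, e _ h1, e _ h2]

/-- The standing hypotheses on `C`: a non-empty weak-⋆ closed convex set whose cone `B(C)` has
interior points, with support function locally bounded there. -/
structure IsTubeSet (C : Set (WeakDual ℝ V)) : Prop where
  nonempty : C.Nonempty
  isClosed : IsClosed C
  convex : Convex ℝ C
  interior_nonempty : (interior (boundedCone C)).Nonempty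
  locallyBounded : LocallyBoundedOn (interior (boundedCone C)) (supportFn C)

namespace IsTubeSet

theorem expC_apply (hC : IsTubeSet C) {s : Cplx V} (hs : s ∈ tube C) (f : C) :
    expC C s f = Complex.exp (Complex.I * dualExt (f : WeakDual ℝ V) s) := by
  refine mkC0_apply ?_ ?_ f
  · exact Complex.continuous_exp.comp (continuous_const.mul (continuous_dualExt C s))
  · rw [tendsto_zero_iff_norm_tendsto_zero]
    simp only [norm_exp_dualExt]
    exact Real.tendsto_exp_neg_atTop_nhds_zero.comp
      (tendsto_eval_cocompact hC.isClosed hC.locallyBounded hs)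

theorem expC_add (hC : IsTubeSet C) {s t : Cplx V} (hs : s ∈ tube C) (ht : t ∈ tube C) :
    expC C (s + t) = expC C s * expC C t := by
  ext f
  rw [ZeroAtInftyContinuousMap.mul_apply, hC.expC_apply hs, hC.expC_apply ht,
    hC.expC_apply (add_mem_tube hs (interior_subset ht)), dualExt_add, mul_add, Complex.exp_add]

/-- The factor `f ↦ f(h)` is dominated by the exponential decay of `exp(i f(s))` along `C`. -/
theorem exists_norm_exp_mul_dualExt_le (hC : IsTubeSet C) {s : Cplx V} (hs : s ∈ tube C) :
    ∃ M : ℝ, ∀ ε : ℝ, 0 < ε → ∀ᶠ h : Cplx V in 𝓝 0, ∀ f ∈ C,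
      ‖Complex.exp (Complex.I * dualExt f s) * dualExt f h‖ ≤ ε * Real.exp M := by
  obtain ⟨M, hM0, hM⟩ := exists_forall_norm_dualExt_le hC.locallyBounded hs
  refine ⟨M, fun ε hε => (hM ε hε).mono fun h hh f hf => ?_⟩
  rw [norm_mul, norm_exp_dualExt]
  have h1 : M + f s.im ≤ Real.exp (M + f s.im) := by linarith [Real.add_one_le_exp (M + f s.im)]
  calc Real.exp (-f s.im) * ‖dualExt f h‖
      ≤ Real.exp (-f s.im) * (ε * Real.exp (M + f s.im)) := by
        gcongr
        exact (hh f hf).trans (by gcongr)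
    _ = ε * (Real.exp (-f s.im) * Real.exp (M + f s.im)) := by ring
    _ = ε * Real.exp M := by rw [← Real.exp_add]; congr 2; ring

theorem exists_norm_exp_mul_dualExt_le_const (hC : IsTubeSet C) {s : Cplx V} (hs : s ∈ tube C)
    (h : Cplx V) : ∃ R : ℝ, ∀ f ∈ C,
      ‖Complex.exp (Complex.I * dualExt f s) * dualExt f h‖ ≤ R := by
  obtain ⟨M, hM⟩ := hC.exists_norm_exp_mul_dualExt_le hs
  obtain ⟨t, ht, hth⟩ := exists_pos_smul_mem (hM 1 one_pos) h
  refine ⟨t⁻¹ * Real.exp M, fun f hf => ?_⟩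
  have := hth f hf
  rw [dualExt_real_smul, mul_left_comm, norm_mul, Complex.norm_of_nonneg ht.le, one_mul] at this
  rwa [inv_mul_eq_div, le_div_iff₀' ht]

theorem expLinC_apply (hC : IsTubeSet C) {s : Cplx V} (hs : s ∈ tube C) (h : Cplx V) (f : C) :
    expLinC C s h f = Complex.exp (Complex.I * dualExt (f : WeakDual ℝ V) s) *
      dualExt (f : WeakDual ℝ V) h := by
  refine mkC0_apply ?_ ?_ f
  · exact (Complex.continuous_exp.comp (continuous_const.mul (continuous_dualExt C s))).mul
      (continuous_dualExt C h)
  · -- Split off half of the exponential: the other half still dominates the linear factor.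
    obtain ⟨R, hR⟩ := hC.exists_norm_exp_mul_dualExt_le_const (half_mem_tube hs) h
    have h0 := (expC C ((2⁻¹ : ℝ) • s)).zero_at_infty'
    refine (h0.zero_mul_isBoundedUnder_le (g := fun f : C =>
      Complex.exp (Complex.I * dualExt (f : WeakDual ℝ V) ((2⁻¹ : ℝ) • s)) *
        dualExt (f : WeakDual ℝ V) h) ⟨R, ?_⟩).congr fun f => ?_
    · exact eventually_map.2 (Eventually.of_forall fun f => hR f f.2)
    · change expC C ((2⁻¹ : ℝ) • s) f * _ = _
      rw [hC.expC_apply (half_mem_tube hs), ← mul_assoc, ← Complex.exp_add, ← mul_add,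
        ← dualExt_add, half_add_half]

theorem expLinC_add_left (hC : IsTubeSet C) {s t : Cplx V} (hs : s ∈ tube C) (ht : t ∈ tube C)
    (h : Cplx V) : expLinC C (s + t) h = expC C s * expLinC C t h := by
  ext f
  rw [ZeroAtInftyContinuousMap.mul_apply, hC.expC_apply hs, hC.expLinC_apply ht,
    hC.expLinC_apply (add_mem_tube hs (interior_subset ht)), dualExt_add, mul_add,
    Complex.exp_add, mul_assoc]

/-- The map `h ↦ expLinC C s h` is complex linear. -/
theorem exists_linearMap_expLinC (hC : IsTubeSet C) {s : Cplx V} (hs : s ∈ tube C) :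
    ∃ L : Cplx V →ₗ[ℂ] C₀(C, ℂ), ∀ h, L h = expLinC C s h :=
  ⟨{ toFun := expLinC C s
     map_add' := fun h k => by
      ext f
      rw [ZeroAtInftyContinuousMap.add_apply, hC.expLinC_apply hs, hC.expLinC_apply hs,
        hC.expLinC_apply hs, dualExt_add, mul_add]
     map_smul' := fun z h => by
      ext f
      rw [RingHom.id_apply, ZeroAtInftyContinuousMap.smul_apply, hC.expLinC_apply hs,
        hC.expLinC_apply hs, dualExt_smul, smul_eq_mul]
      ring }, fun _ => rfl⟩

theorem continuous_expLinC (hC : IsTubeSet C) {s : Cplx V} (hs : s ∈ tube C) :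
    Continuous (expLinC C s) := by
  obtain ⟨L, hL⟩ := hC.exists_linearMap_expLinC hs
  obtain ⟨M, hM⟩ := hC.exists_norm_exp_mul_dualExt_le hs
  suffices h : Continuous L from h.congr hL
  refine continuous_of_continuousAt_zero L ?_
  rw [ContinuousAt, map_zero, Metric.tendsto_nhds]
  intro ε hε
  filter_upwards [hM (ε / 2 * Real.exp (-M)) (by positivity)] with h hh
  rw [dist_zero_right, hL]
  refine (norm_le_of_forall_norm_le (by positivity) fun f => ?_).trans_lt (half_lt_self hε)
  rw [hC.expLinC_apply hs]
  refine (hh f f.2).trans_eq ?_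
  rw [mul_assoc, ← Real.exp_add, neg_add_cancel, Real.exp_zero, mul_one]

/-- Continuity of `s ↦ exp(i f(s))` for the sup norm on `C`, from `|e^z - 1| ≤ |z| e^{|z|}`. -/
theorem continuousAt_expC (hC : IsTubeSet C) {s : Cplx V} (hs : s ∈ tube C) :
    ContinuousAt (expC C) s := by
  obtain ⟨M, hM0, hM⟩ := exists_forall_norm_dualExt_le hC.locallyBounded hs
  rw [ContinuousAt, Metric.tendsto_nhds]
  intro δ hδ
  set ε : ℝ := min (1 / 2) (δ / 4 * Real.exp (-M)) with hε
  have hε0 : 0 < ε := lt_min (by norm_num) (by positivity)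
  have hsub : Tendsto (fun t => t - s) (𝓝 s) (𝓝 0) := by
    simpa using (continuous_sub_right s).tendsto s
  filter_upwards [hsub.eventually (hM ε hε0), isOpen_tube.mem_nhds hs] with t ht hts
  rw [dist_eq_norm]
  refine (norm_le_of_forall_norm_le (r := δ / 2) (by positivity) fun f => ?_).trans_lt
    (half_lt_self hδ)
  set p := M + (f : WeakDual ℝ V) s.im with hp
  have hp0 : 0 ≤ p := hM0 f f.2
  set z := Complex.I * dualExt (f : WeakDual ℝ V) (t - s) with hz
  have hzn : ‖z‖ ≤ ε * p := by simpa [hz] using ht f f.2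
  have h1 : ‖Complex.exp z - 1‖ ≤ ‖z‖ * Real.exp ‖z‖ := by
    simpa using Complex.norm_exp_sub_sum_le_norm_mul_exp z 1
  have h2 : p ≤ 2 * Real.exp (p / 2) := by linarith [Real.add_one_le_exp (p / 2)]
  have h3 : expC C t f - expC C s f =
      Complex.exp (Complex.I * dualExt (f : WeakDual ℝ V) s) * (Complex.exp z - 1) := by
    rw [hC.expC_apply hts, hC.expC_apply hs, mul_sub, ← Complex.exp_add, hz, mul_one, ← mul_add,
      ← dualExt_add, add_sub_cancel]
  rw [ZeroAtInftyContinuousMap.sub_apply, h3, norm_mul, norm_exp_dualExt]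
  calc Real.exp (-(f : WeakDual ℝ V) s.im) * ‖Complex.exp z - 1‖
      ≤ Real.exp (M - p) * (ε * (2 * Real.exp (p / 2)) * Real.exp (p / 2)) := by
        have e1 : -(f : WeakDual ℝ V) s.im = M - p := by rw [hp]; ring
        rw [e1]
        gcongr
        refine h1.trans ?_
        have e2 : ‖z‖ ≤ p / 2 := hzn.trans (by
          have := min_le_left (1 / 2) (δ / 4 * Real.exp (-M))
          rw [← hε] at this
          nlinarith)
        have e3 : ‖z‖ ≤ ε * (2 * Real.exp (p / 2)) := hzn.trans (by gcongr)
        gcongr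
    _ = 2 * ε * (Real.exp (M - p) * (Real.exp (p / 2) * Real.exp (p / 2))) := by ring
    _ = 2 * ε * Real.exp M := by
        rw [← Real.exp_add, ← Real.exp_add]
        congr 2
        ring
    _ ≤ 2 * (δ / 4 * Real.exp (-M)) * Real.exp M := by
        gcongr
        exact min_le_right _ _
    _ = δ / 2 * (Real.exp (-M) * Real.exp M) := by ring
    _ = δ / 2 := by rw [← Real.exp_add, neg_add_cancel, Real.exp_zero, mul_one]

/-- Joint continuity, from `expLinC C s h = expC C (s - s₀ / 2) * expLinC C (s₀ / 2) h` for `s` near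
`s₀`. -/
theorem continuousAt_expLinC (hC : IsTubeSet C) {s : Cplx V} (hs : s ∈ tube C) (h : Cplx V) :
    ContinuousAt (fun p : Cplx V × Cplx V => expLinC C p.1 p.2) (s, h) := by
  set t := (2⁻¹ : ℝ) • s with ht
  have htC : t ∈ tube C := half_mem_tube hs
  have hst : s - t = t := sub_eq_of_eq_add (half_add_half s).symm
  have h1 : Continuous fun p : Cplx V × Cplx V => p.1 - t := continuous_fst.sub continuous_const
  have h2 : ContinuousAt (fun p : Cplx V × Cplx V => expC C (p.1 - t)) (s, h) :=
    ContinuousAt.comp (f := fun p : Cplx V × Cplx V => p.1 - t) (g := expC C)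
      (hC.continuousAt_expC (by simpa [hst] using htC)) h1.continuousAt
  have h3 : ContinuousAt (fun p : Cplx V × Cplx V => expLinC C t p.2) (s, h) :=
    ((hC.continuous_expLinC htC).comp continuous_snd).continuousAt
  refine (h2.mul h3).congr ?_
  have h4 : ∀ᶠ p : Cplx V × Cplx V in 𝓝 (s, h), p.1 - t ∈ tube C :=
    h1.continuousAt.eventually (isOpen_tube.mem_nhds (by simpa [hst] using htC))
  filter_upwards [h4] with p hp
  change expC C (p.1 - t) * expLinC C t p.2 = _
  rw [← hC.expLinC_add_left hp htC, sub_add_cancel]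

end IsTubeSet

end Exponential

end HostTube

/-! ### Holomorphy of the exponential family -/

namespace HostTube

variable {V : Type u} [AddCommGroup V] [Module ℝ V] [TopologicalSpace V]
  [IsTopologicalAddGroup V] [ContinuousSMul ℝ V] {C : Set (WeakDual ℝ V)}

namespace IsTubeSet

theorem norm_expC_le (hC : IsTubeSet C) {s : Cplx V} (hs : s ∈ tube C) :
    ‖expC C s‖ ≤ alphaC C s := by
  refine norm_le_of_forall_norm_le (Real.exp_pos _).le fun f => ?_
  rw [hC.expC_apply hs, norm_exp_dualExt, alphaC]
  gcongr
  exact sInf_pairing_le (interior_subset hs) f.2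

theorem eventually_add_smul_mem_tube {s : Cplx V} (hs : s ∈ tube C) (h : Cplx V) :
    ∀ᶠ t : ℝ in 𝓝 0, s + t • h ∈ tube C := by
  have hc : Continuous fun t : ℝ => s + t • h := by fun_prop
  exact hc.continuousAt.eventually (isOpen_tube.mem_nhds (by simpa using hs))

theorem hasDirDeriv_expC (hC : IsTubeSet C) {s : Cplx V} (hs : s ∈ tube C) (h : Cplx V) :
    HasDirDeriv (expC C) s h (Complex.I • expLinC C s h) := by
  have key := hasDirDeriv_of_pointwise (F := expC C) (x := s) (h := h)
    (F' := fun t => Complex.I • expLinC C (s + t • h) h) ?_ ?_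
  · simpa using key
  · have hopen : ∀ᶠ t : ℝ in 𝓝 0, ∀ᶠ t' in 𝓝 t, s + t' • h ∈ tube C :=
      (eventually_add_smul_mem_tube hs h).eventually_nhds
    filter_upwards [hopen] with t ht f
    have h1 : HasDerivAt (fun t : ℝ => Complex.exp (Complex.I *
        (dualExt (f : WeakDual ℝ V) s + t * dualExt (f : WeakDual ℝ V) h)))
        (Complex.exp (Complex.I *
        (dualExt (f : WeakDual ℝ V) s + t * dualExt (f : WeakDual ℝ V) h)) *
          (Complex.I * (1 * dualExt (f : WeakDual ℝ V) h))) t :=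
      ((((Complex.ofRealCLM.hasDerivAt (x := t)).mul_const _).const_add _).const_mul _).cexp
    have h2 : ∀ t : ℝ, dualExt (f : WeakDual ℝ V) s + t * dualExt (f : WeakDual ℝ V) h =
        dualExt (f : WeakDual ℝ V) (s + t • h) := fun t => by
      rw [dualExt_add, dualExt_real_smul]
    simp only [h2] at h1
    refine (h1.congr_of_eventuallyEq ?_).congr_deriv ?_
    · filter_upwards [ht] with t' ht'
      rw [hC.expC_apply ht']
    · rw [ZeroAtInftyContinuousMap.smul_apply, hC.expLinC_apply ht.self_of_nhds, smul_eq_mul]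
      ring
  · have hc : Continuous fun t : ℝ => (s + t • h, h) := by fun_prop
    have := ContinuousAt.comp (f := fun t : ℝ => (s + t • h, h)) (x := (0 : ℝ))
      (g := fun p : Cplx V × Cplx V => expLinC C p.1 p.2)
      (by simpa using hC.continuousAt_expLinC hs h) hc.continuousAt
    exact this.const_smul Complex.I

theorem hasDirDeriv_expLinC (hC : IsTubeSet C) {s : Cplx V} (hs : s ∈ tube C)
    (h s' h' : Cplx V) :
    HasDirDeriv (fun p : Cplx V × Cplx V => expLinC C p.1 p.2) (s, h) (s', h')
      (Complex.I • (expLinC C ((2⁻¹ : ℝ) • s) h * expLinC C ((2⁻¹ : ℝ) • s) s') +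
        expLinC C s h') := by
  have key := hasDirDeriv_of_pointwise (F := fun p : Cplx V × Cplx V => expLinC C p.1 p.2)
    (x := (s, h)) (h := (s', h'))
    (F' := fun t : ℝ => Complex.I • (expLinC C ((2⁻¹ : ℝ) • (s + t • s')) (h + t • h') *
      expLinC C ((2⁻¹ : ℝ) • (s + t • s')) s') + expLinC C (s + t • s') h') ?_ ?_
  · simpa using key
  · have hopen : ∀ᶠ t : ℝ in 𝓝 0, ∀ᶠ t' in 𝓝 t, s + t' • s' ∈ tube C :=
      (eventually_add_smul_mem_tube hs s').eventually_nhds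
    filter_upwards [hopen] with t ht f
    set φ := dualExt (f : WeakDual ℝ V) with hφ
    have h1 : HasDerivAt (fun t : ℝ => Complex.exp (Complex.I * (φ s + t * φ s')))
        (Complex.exp (Complex.I * (φ s + t * φ s')) * (Complex.I * (1 * φ s'))) t :=
      ((((Complex.ofRealCLM.hasDerivAt (x := t)).mul_const _).const_add _).const_mul _).cexp
    have h1' : HasDerivAt (fun t : ℝ => φ h + t * φ h') (1 * φ h') t :=
      ((Complex.ofRealCLM.hasDerivAt (x := t)).mul_const _).const_add _
    have h2 : ∀ (a b : Cplx V) (t : ℝ), φ a + t * φ b = φ (a + t • b) := fun a b t => by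
      rw [hφ, dualExt_add, dualExt_real_smul]
    have h3 := h1.mul h1'
    simp only [h2] at h3
    refine (h3.congr_of_eventuallyEq ?_).congr_deriv ?_
    · filter_upwards [ht] with t' ht'
      exact hC.expLinC_apply ht' _ f
    · have hts := ht.self_of_nhds
      rw [ZeroAtInftyContinuousMap.add_apply, ZeroAtInftyContinuousMap.smul_apply,
        ZeroAtInftyContinuousMap.mul_apply, hC.expLinC_apply (half_mem_tube hts),
        hC.expLinC_apply (half_mem_tube hts), hC.expLinC_apply hts, smul_eq_mul]
      have h4 : Complex.exp (Complex.I * φ (s + t • s')) =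
          Complex.exp (Complex.I * φ ((2⁻¹ : ℝ) • (s + t • s'))) *
          Complex.exp (Complex.I * φ ((2⁻¹ : ℝ) • (s + t • s'))) := by
        rw [← Complex.exp_add, ← mul_add, hφ, ← dualExt_add, half_add_half]
      rw [h4]
      ring
  · have main : ∀ (a b : Cplx V) (r : ℝ), 0 < r → ContinuousAt
        (fun t : ℝ => expLinC C (r • (s + t • s')) (a + t • b)) 0 := fun a b r hr => by
      have hc : Continuous fun t : ℝ => (r • (s + t • s'), a + t • b) := by fun_prop
      exact ContinuousAt.comp (f := fun t : ℝ => (r • (s + t • s'), a + t • b)) (x := (0 : ℝ))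
        (g := fun p : Cplx V × Cplx V => expLinC C p.1 p.2)
        (by simpa using hC.continuousAt_expLinC (smul_mem_tube hs hr) a) hc.continuousAt
    have m1 := main h h' 2⁻¹ (by norm_num)
    have m2 := main s' 0 2⁻¹ (by norm_num)
    have m3 := main h' 0 1 one_pos
    simp only [smul_zero, add_zero, one_smul] at m2 m3
    exact ((m1.mul m2).const_smul Complex.I).add m3

/-- Both `expC` and `expLinC` are `C^n`: their differentials are polynomials in the functions
themselves, composed with linear maps, so that the claim follows by induction on `n`. -/
theorem isCn_expC (hC : IsTubeSet C) (n : ℕ) :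
    IsCn n (tube C) (expC C) ∧
      IsCn n (tube C ×ˢ (univ : Set (Cplx V))) (fun p : Cplx V × Cplx V => expLinC C p.1 p.2) := by
  have c1 : ContinuousOn (expC C) (tube C) := fun s hs =>
    (hC.continuousAt_expC hs).continuousWithinAt
  have c2 : ContinuousOn (fun p : Cplx V × Cplx V => expLinC C p.1 p.2)
      (tube C ×ˢ (univ : Set (Cplx V))) := fun p hp =>
    (hC.continuousAt_expLinC hp.1 p.2).continuousWithinAt
  let T : C₀(C, ℂ) →L[ℝ] C₀(C, ℂ) :=
    (Complex.I • ContinuousLinearMap.id ℂ C₀(C, ℂ)).restrictScalars ℝ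
  induction n with
  | zero => exact ⟨c1, c2⟩
  | succ n ih =>
    obtain ⟨-, i2⟩ := ih
    refine ⟨⟨c1, fun p => Complex.I • expLinC C p.1 p.2,
      fun s hs h => hC.hasDirDeriv_expC hs h, i2.clm_comp T⟩, c2, fun q =>
      Complex.I • (expLinC C ((2⁻¹ : ℝ) • q.1.1) q.1.2 * expLinC C ((2⁻¹ : ℝ) • q.1.1) q.2.1) +
        expLinC C q.1.1 q.2.2, fun p hp h => hC.hasDirDeriv_expLinC hp.1 p.2 h.1 h.2, ?_⟩
    let E := Cplx V
    let fstfst : (E × E) × (E × E) →L[ℝ] E :=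
      (ContinuousLinearMap.fst ℝ E E).comp (ContinuousLinearMap.fst ℝ (E × E) (E × E))
    let fstsnd : (E × E) × (E × E) →L[ℝ] E :=
      (ContinuousLinearMap.snd ℝ E E).comp (ContinuousLinearMap.fst ℝ (E × E) (E × E))
    let sndfst : (E × E) × (E × E) →L[ℝ] E :=
      (ContinuousLinearMap.fst ℝ E E).comp (ContinuousLinearMap.snd ℝ (E × E) (E × E))
    let sndsnd : (E × E) × (E × E) →L[ℝ] E :=
      (ContinuousLinearMap.snd ℝ E E).comp (ContinuousLinearMap.snd ℝ (E × E) (E × E))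
    have main : ∀ (r : ℝ) (_ : 0 < r) (A : (E × E) × (E × E) →L[ℝ] E),
        IsCn n ((tube C ×ˢ (univ : Set E)) ×ˢ (univ : Set (E × E)))
          (fun q => expLinC C (r • q.1.1) (A q)) := fun r hr A => by
      have := i2.comp_affine ((r • fstfst).prod A) 0
        (U' := (tube C ×ˢ (univ : Set E)) ×ˢ (univ : Set (E × E)))
        fun q hq => by simpa [fstfst] using smul_mem_tube hq.1.1 hr
      simpa [fstfst] using this
    have m1 := main 2⁻¹ (by norm_num) fstsnd
    have m2 := main 2⁻¹ (by norm_num) sndfst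
    have m3 := main 1 one_pos sndsnd
    simp only [one_smul] at m3
    exact ((m1.mul m2).clm_comp T).add m3

theorem holomorphicOn_expC (hC : IsTubeSet C) : HolomorphicOn (tube C) (expC C) := by
  refine ⟨fun n => (hC.isCn_expC n).1, fun s hs => ?_⟩
  obtain ⟨L, hL⟩ := hC.exists_linearMap_expLinC hs
  refine ⟨Complex.I • L, fun h => ?_⟩
  rw [LinearMap.smul_apply, hL]
  exact hC.hasDirDeriv_expC hs h

end IsTubeSet

end HostTube

/-! ### The tube as a complex involutive semigroup -/

namespace HostTube

variable {V : Type u} [AddCommGroup V] [Module ℝ V] [TopologicalSpace V]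
  {C : Set (WeakDual ℝ V)}

theorem dualExt_inv (f : WeakDual ℝ V) (s : Cplx V) :
    Complex.I * dualExt f s.inv = (starRingEnd ℂ) (Complex.I * dualExt f s) := by
  apply Complex.ext <;> simp [dualExt]

/-- The involution `x + iy ↦ -x + iy` of the complexification, as a conjugate-linear map. -/
def Cplx.invₛₗ : Cplx V →ₛₗ[starRingEnd ℂ] Cplx V where
  toFun := Cplx.inv
  map_add' s t := by ext <;> simp [add_comm]
  map_smul' z s := by ext <;> simp; abel

theorem alphaC_mul_le (hne : C.Nonempty) {s t : Cplx V} (hs : s ∈ tube C) (ht : t ∈ tube C) :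
    alphaC C (s + t) ≤ alphaC C s * alphaC C t := by
  rw [alphaC, alphaC, alphaC, ← Real.exp_add, Cplx.im_add]
  gcongr
  linarith [sInf_pairing_add_le hne (interior_subset hs) (interior_subset ht)]

theorem isSemigroupAbsValue_alphaC (hne : C.Nonempty) :
    IsSemigroupAbsValue (tube C) (fun s t => s + t) Cplx.inv (alphaC C) where
  nonneg _ _ := (Real.exp_pos _).le
  map_st _ _ := rfl
  map_mul_le _ hs _ ht := alphaC_mul_le hne hs ht

theorem IsTubeSet.locallyBoundedOn_alphaC (hC : IsTubeSet C) :
    LocallyBoundedOn (tube C) (alphaC C) := by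
  intro s hs
  obtain ⟨U, hU, M, hM⟩ := hC.locallyBounded s.im hs
  rw [isOpen_interior.nhdsWithin_eq hs] at hU
  refine ⟨Cplx.im ⁻¹' U, mem_nhdsWithin_of_mem_nhds
    (Cplx.continuous_im.continuousAt.preimage_mem_nhds hU), Real.exp M, fun t ht => ?_⟩
  rw [alphaC, abs_of_pos (Real.exp_pos _)]
  gcongr
  exact (abs_le.1 (hM _ ht)).2

variable [IsTopologicalAddGroup V]

theorem isComplexInvSemigroup_tube :
    IsComplexInvSemigroup (tube C) (fun s t => s + t) Cplx.inv where
  isOpen := isOpen_tube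
  mul_mem _ hs _ ht := add_mem_tube hs (interior_subset ht)
  mul_assoc _ _ _ _ _ _ := add_assoc _ _ _
  st_mem _ hs := hs
  st_st s _ := by ext <;> simp
  st_mul s _ t _ := (Cplx.invₛₗ.map_add s t).trans (add_comm _ _)
  holomorphic_mul := by
    let L : Cplx V × Cplx V →ₗ[ℂ] Cplx V := LinearMap.fst ℂ _ _ + LinearMap.snd ℂ _ _
    let T : Cplx V × Cplx V →L[ℝ] Cplx V :=
      ContinuousLinearMap.fst ℝ _ _ + ContinuousLinearMap.snd ℝ _ _
    refine ⟨fun n => isCn_clm _ T, fun p _ => ⟨L, fun h => ?_⟩⟩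
    exact hasDirDeriv_clm T p h
  antiholomorphic_st := by
    let T : Cplx V →L[ℝ] Cplx V :=
      { toFun := Cplx.inv
        map_add' := Cplx.invₛₗ.map_add
        map_smul' := fun r s => by ext <;> simp
        cont := (Cplx.continuous_re.neg.prodMk Cplx.continuous_im : _) }
    exact ⟨fun n => isCn_clm _ T, fun p _ => ⟨Cplx.invₛₗ, fun h => hasDirDeriv_clm T p h⟩⟩

variable [ContinuousSMul ℝ V]

namespace IsTubeSet

/-- The morphism `γ : S → C₀(C)`, `γ(s)(f) = exp(i f(s))`. -/
noncomputable def gamma (hC : IsTubeSet C) :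
    HolMorphism (tube C) (fun s t => s + t) Cplx.inv (alphaC C) C₀(C, ℂ) where
  toFun := expC C
  map_mul _ hs _ ht := hC.expC_add hs ht
  map_st s hs := by
    ext f
    have hs' : s.inv ∈ tube C := hs
    rw [ZeroAtInftyContinuousMap.star_apply, hC.expC_apply hs, hC.expC_apply hs', dualExt_inv,
      Complex.exp_conj]
    rfl
  bounded _ hs := hC.norm_expC_le hs
  holomorphic := hC.holomorphicOn_expC

end IsTubeSet

end HostTube

/-! ### Density of the exponential family -/

namespace HostTube

section StoneWeierstrass

variable {K : Type u} [TopologicalSpace K] [T2Space K]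

/-- The extension of `g ∈ C₀(K)` to the one-point compactification by `0` at `∞`. -/
noncomputable def onePointExt (g : C₀(K, ℂ)) : C(OnePoint K, ℂ) where
  toFun x := x.elim 0 g
  continuous_toFun := by
    rw [OnePoint.continuous_iff]
    exact ⟨by simpa [coclosedCompact_eq_cocompact] using g.zero_at_infty', g.continuous⟩

@[simp] theorem onePointExt_coe (g : C₀(K, ℂ)) (x : K) : onePointExt g (x : OnePoint K) = g x := rfl
@[simp] theorem onePointExt_infty (g : C₀(K, ℂ)) : onePointExt g OnePoint.infty = 0 := rfl

/-- The Stone–Weierstrass theorem for `C₀(K)`: adjoining the constants to a `⋆`-subalgebra of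
`C₀(K)` gives a `⋆`-subalgebra of functions on the one-point compactification. -/
theorem dense_of_separatesPoints [LocallyCompactSpace K]
    (N : NonUnitalStarSubalgebra ℂ C₀(K, ℂ))
    (hsep : ∀ x y : K, x ≠ y → ∃ g ∈ N, g x ≠ g y) (hne : ∀ x : K, ∃ g ∈ N, g x ≠ 0) :
    Dense (N : Set C₀(K, ℂ)) := by
  let B : StarSubalgebra ℂ C(OnePoint K, ℂ) :=
    { carrier := {b | ∃ c : ℂ, ∃ g ∈ N, b = algebraMap ℂ _ c + onePointExt g}
      mul_mem' := by
        rintro _ _ ⟨c, g, hg, rfl⟩ ⟨d, k, hk, rfl⟩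
        refine ⟨c * d, c • k + d • g + g * k,
          add_mem (add_mem (SMulMemClass.smul_mem c hk) (SMulMemClass.smul_mem d hg))
            (mul_mem hg hk), ?_⟩
        ext x
        induction x using OnePoint.rec with
        | infty => simp
        | coe x => simp; ring
      add_mem' := by
        rintro _ _ ⟨c, g, hg, rfl⟩ ⟨d, k, hk, rfl⟩
        refine ⟨c + d, g + k, add_mem hg hk, ?_⟩
        ext x
        induction x using OnePoint.rec with
        | infty => simp
        | coe x => simp; ring
      algebraMap_mem' := fun c => ⟨c, 0, zero_mem N, by
        ext x
        induction x using OnePoint.rec <;> simp⟩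
      star_mem' := by
        rintro _ ⟨c, g, hg, rfl⟩
        refine ⟨star c, star g, star_mem hg, ?_⟩
        ext x
        induction x using OnePoint.rec <;> simp }
  have hB : ∀ g ∈ N, onePointExt g ∈ B := fun g hg => ⟨0, g, hg, by simp⟩
  have hBsep : B.SeparatesPoints := by
    intro x y hxy
    have aux : ∀ g ∈ N, onePointExt g x ≠ onePointExt g y →
        ∃ f ∈ (fun f : C(OnePoint K, ℂ) => (f : OnePoint K → ℂ)) '' (B.toSubalgebra : Set _),
          f x ≠ f y := fun g hg h => ⟨_, ⟨_, hB g hg, rfl⟩, h⟩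
    induction x using OnePoint.rec with
    | infty =>
      induction y using OnePoint.rec with
      | infty => exact absurd rfl hxy
      | coe y =>
        obtain ⟨g, hg, h⟩ := hne y
        exact aux g hg (by simpa using h.symm)
    | coe x =>
      induction y using OnePoint.rec with
      | infty =>
        obtain ⟨g, hg, h⟩ := hne x
        exact aux g hg (by simpa using h)
      | coe y =>
        obtain ⟨g, hg, h⟩ := hsep x y (fun e => hxy (by rw [e]))
        exact aux g hg (by simpa using h)
  have hdense := ContinuousMap.starSubalgebra_topologicalClosure_eq_top_of_separatesPoints B hBsep
  intro g
  rw [Metric.mem_closure_iff]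
  intro ε hε
  have hg : onePointExt g ∈ closure (B : Set C(OnePoint K, ℂ)) := by
    rw [← StarSubalgebra.topologicalClosure_coe, hdense]
    trivial
  obtain ⟨_, ⟨c, k, hk, rfl⟩, h⟩ := Metric.mem_closure_iff.1 hg (ε / 3) (by positivity)
  rw [dist_eq_norm] at h
  have hp := fun x => ((onePointExt g - (algebraMap ℂ _ c + onePointExt k)).norm_coe_le_norm x).trans
    h.le
  -- The value at `∞` bounds the constant term.
  have hc : ‖c‖ ≤ ε / 3 := by simpa using hp OnePoint.infty
  refine ⟨k, hk, ?_⟩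
  rw [dist_eq_norm]
  refine (norm_le_of_forall_norm_le (r := ε / 3 + ε / 3) (by positivity) fun x => ?_).trans_lt
    (by linarith)
  have hx : ‖g x - (c + k x)‖ ≤ ε / 3 := by simpa using hp x
  calc ‖(g - k) x‖ = ‖(g x - (c + k x)) + c‖ := by
        rw [ZeroAtInftyContinuousMap.sub_apply]; congr 1; ring
    _ ≤ _ := (norm_add_le _ _).trans (add_le_add hx hc)

end StoneWeierstrass

section Span

variable {A : Type u} [NonUnitalCStarAlgebra A]

/-- A set closed under multiplication and involution spans the `⋆`-subalgebra it generates. -/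
theorem adjoin_le_span {T : Set A} (hmul : ∀ a ∈ T, ∀ b ∈ T, a * b ∈ T)
    (hstar : ∀ a ∈ T, star a ∈ T) {x : A} (hx : x ∈ NonUnitalStarAlgebra.adjoin ℂ T) :
    x ∈ Submodule.span ℂ T := by
  have h : x ∈ (NonUnitalStarAlgebra.adjoin ℂ T).toSubmodule := hx
  rw [NonUnitalStarAlgebra.adjoin_eq_span] at h
  have h1 : T ∪ star T = T := union_eq_left.2 fun a ha => by simpa using hstar _ ha
  rw [h1] at h
  refine Submodule.span_mono (fun a ha => ?_) h
  exact Subsemigroup.closure_induction (p := fun a _ => a ∈ T) (fun a ha => ha)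
    (fun a b _ _ ha hb => hmul a ha b hb) ha

end Span

section Density

variable {V : Type u} [AddCommGroup V] [Module ℝ V] [TopologicalSpace V]
  [IsTopologicalAddGroup V] [ContinuousSMul ℝ V] {C : Set (WeakDual ℝ V)}

theorem IsTubeSet.dense_adjoin_expC (hC : IsTubeSet C) :
    Dense (NonUnitalStarAlgebra.adjoin ℂ (expC C '' tube C) : Set C₀(C, ℂ)) := by
  have := locallyCompactSpace_of_interior_nonempty hC.isClosed hC.locallyBounded
    hC.interior_nonempty
  have hI : ∀ y ∈ interior (boundedCone C), Cplx.mk 0 y ∈ tube C := fun y hy => hy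
  have hval : ∀ y ∈ interior (boundedCone C), ∀ f : C,
      expC C (Cplx.mk 0 y) f = (Real.exp (-(f : WeakDual ℝ V) y) : ℂ) := fun y hy f => by
    rw [hC.expC_apply (hI y hy)]
    simp [dualExt, ← mul_assoc]
  have hmem : ∀ y ∈ interior (boundedCone C), expC C (Cplx.mk 0 y) ∈
      NonUnitalStarAlgebra.adjoin ℂ (expC C '' tube C) := fun y hy =>
    NonUnitalStarAlgebra.subset_adjoin ℂ _ ⟨_, hI y hy, rfl⟩
  refine dense_of_separatesPoints _ (fun f g hfg => ?_) fun f => ?_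
  · obtain ⟨y, hy, hne⟩ := exists_mem_interior_ne hC.interior_nonempty
      (fun h => hfg (Subtype.ext h))
    refine ⟨_, hmem y hy, fun h => hne ?_⟩
    rw [hval y hy, hval y hy, Complex.ofReal_inj, Real.exp_eq_exp] at h
    exact neg_injective h
  · obtain ⟨y, hy⟩ := hC.interior_nonempty
    refine ⟨_, hmem y hy, ?_⟩
    rw [hval y hy]
    exact_mod_cast (Real.exp_pos _).ne'

/-- The functions `exp(i f(s))`, `s` in the tube, span a dense subspace of `C₀(C)`. -/
theorem IsTubeSet.dense_span_expC (hC : IsTubeSet C) :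
    Dense (Submodule.span ℂ (expC C '' tube C) : Set C₀(C, ℂ)) := by
  refine hC.dense_adjoin_expC.mono fun x hx => adjoin_le_span ?_ ?_ hx
  · rintro _ ⟨s, hs, rfl⟩ _ ⟨t, ht, rfl⟩
    exact ⟨s + t, add_mem_tube hs (interior_subset ht), hC.expC_add hs ht⟩
  · rintro _ ⟨s, hs, rfl⟩
    exact ⟨s.inv, hs, hC.gamma.map_st s hs⟩

end Density

end HostTube

/-! ### Holomorphic characters of the tube -/

namespace HostTube

variable {V : Type u} [AddCommGroup V] [Module ℝ V] [TopologicalSpace V]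
  [IsTopologicalAddGroup V] [ContinuousSMul ℝ V] {C : Set (WeakDual ℝ V)}

/-- The logarithmic derivative of a holomorphic character is a constant complex linear functional,
so that the character is its exponential. -/
theorem exists_eq_exp_of_character {α : Cplx V → ℝ}
    (χ : HolMorphism (tube C) (fun s t => s + t) Cplx.inv α ℂ)
    {s₀ : Cplx V} (hs₀ : s₀ ∈ tube C) (h0 : χ.toFun s₀ ≠ 0) :
    ∃ L : Cplx V →ₗ[ℂ] ℂ, Continuous L ∧ ∀ z ∈ tube C, χ.toFun z = Complex.exp (L z) := by
  obtain ⟨hsm, hlin⟩ := χ.holomorphic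
  obtain ⟨L, hL⟩ := hlin s₀ hs₀
  obtain ⟨-, df, hdf, hdfc⟩ := hsm 1
  have hLc : Continuous L := by
    have h1 : ∀ h, L h = df (s₀, h) := fun h => tendsto_nhds_unique (hL h) (hdf s₀ hs₀ h)
    have h2 : Continuous fun h => df (s₀, h) :=
      ContinuousOn.comp_continuous (f := fun h : Cplx V => (s₀, h))
        (hdfc : ContinuousOn df _) (by fun_prop) fun h => ⟨hs₀, mem_univ _⟩
    exact h2.congr fun h => (h1 h).symm
  have hmul : ∀ s ∈ tube C, ∀ t ∈ tube C, χ.toFun (s + t) = χ.toFun s * χ.toFun t := χ.map_mul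
  have hder : ∀ t ∈ tube C, ∀ h, HasDirDeriv χ.toFun t h
      ((χ.toFun s₀)⁻¹ * χ.toFun t * L h) := fun t ht h => by
    refine ((hL h).const_mul _).congr' ?_
    have e1 := nhdsWithin_le_nhds (s := {0}ᶜ) (IsTubeSet.eventually_add_smul_mem_tube ht h)
    have e2 := nhdsWithin_le_nhds (s := {0}ᶜ) (IsTubeSet.eventually_add_smul_mem_tube hs₀ h)
    filter_upwards [e1, e2] with r h1 h2
    have e : χ.toFun t * χ.toFun (s₀ + r • h) = χ.toFun s₀ * χ.toFun (t + r • h) := by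
      rw [← hmul _ ht _ h2, ← hmul _ hs₀ _ h1]
      congr 1
      abel
    rw [mul_smul_comm]
    congr 1
    field_simp
    linear_combination e
  refine ⟨(χ.toFun s₀)⁻¹ • L, hLc.const_smul _, fun z hz => ?_⟩
  set c : ℂ := ((χ.toFun s₀)⁻¹ • L) z with hc
  have hmem : ∀ r : ℝ, 0 ≤ r → s₀ + r • z ∈ tube C := fun r hr =>
    add_mem_tube hs₀ (by
      rw [Cplx.im_real_smul]; exact smul_mem_boundedCone (interior_subset hz) hr)
  have hd1 : ∀ r : ℝ, 0 ≤ r → HasDerivAt (fun r : ℝ => χ.toFun (s₀ + r • z))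
      (χ.toFun (s₀ + r • z) * c) r := fun r hr => by
    rw [hasDerivAt_iff_tendsto_slope_zero]
    have e : χ.toFun (s₀ + r • z) * c = (χ.toFun s₀)⁻¹ * χ.toFun (s₀ + r • z) * L z := by
      rw [hc, LinearMap.smul_apply, smul_eq_mul]; ring
    rw [e]
    refine (hder _ (hmem r hr) z).congr fun t => ?_
    rw [add_smul, add_assoc]
  have hd2 : ∀ r : ℝ, HasDerivAt (fun r : ℝ => Complex.exp (-(r * c)))
      (Complex.exp (-(r * c)) * -(1 * c)) r := fun r =>
    ((Complex.ofRealCLM.hasDerivAt (x := r)).mul_const c).neg.cexp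
  have hd : ∀ r : ℝ, 0 ≤ r → HasDerivAt (fun r : ℝ => χ.toFun (s₀ + r • z) *
      Complex.exp (-(r * c))) 0 r := fun r hr => by
    refine ((hd1 r hr).mul (hd2 r)).congr_deriv ?_
    ring
  have key := constant_of_has_deriv_right_zero (a := 0) (b := 1)
    (fun r hr => (hd r hr.1).continuousAt.continuousWithinAt)
    (fun r hr => (hd r hr.1).hasDerivWithinAt) 1 (by simp)
  simp only [one_smul, zero_smul, add_zero, Complex.ofReal_one, Complex.ofReal_zero, zero_mul,
    neg_zero, Complex.exp_zero, mul_one, one_mul] at key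
  rw [hmul _ hs₀ _ hz, mul_assoc] at key
  have key' := mul_left_cancel₀ h0 (key.trans (mul_one _).symm)
  rw [Complex.exp_neg] at key'
  exact (mul_inv_eq_one₀ (Complex.exp_ne_zero _)).1 key'

/-- A nonzero `α_C`-bounded holomorphic character of the tube is `s ↦ exp(i f(s))` for some `f ∈ C`:
the involution forces `f` to be real, and the bound forces `f ∈ C`. -/
theorem IsTubeSet.exists_mem_of_character (hC : IsTubeSet C)
    (χ : HolMorphism (tube C) (fun s t => s + t) Cplx.inv (alphaC C) ℂ)
    {s₀ : Cplx V} (hs₀ : s₀ ∈ tube C) (h0 : χ.toFun s₀ ≠ 0) :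
    ∃ f ∈ C, ∀ s ∈ tube C, χ.toFun s = Complex.exp (Complex.I * dualExt f s) := by
  obtain ⟨L, hLc, hL⟩ := exists_eq_exp_of_character χ hs₀ h0
  have hnorm : ∀ (x y : V), y ∈ interior (boundedCone C) →
      ‖χ.toFun (Cplx.mk x y)‖ ^ 2 = ‖χ.toFun (Cplx.mk 0 (y + y))‖ := fun x y hy => by
    have h1 : χ.toFun ((Cplx.mk x y).inv + Cplx.mk x y) =
        χ.toFun (Cplx.mk x y).inv * χ.toFun (Cplx.mk x y) :=
      χ.map_mul (Cplx.mk x y).inv hy (Cplx.mk x y) hy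
    have h2 : χ.toFun (Cplx.mk x y).inv = star (χ.toFun (Cplx.mk x y)) := χ.map_st _ hy
    have h3 : (Cplx.mk x y).inv + Cplx.mk x y = Cplx.mk 0 (y + y) := by ext <;> simp
    rw [← h3, h1, h2, norm_mul, norm_star, sq]
  have hmk : ∀ x y : V, L (Cplx.mk x y) = L (Cplx.mk x 0) + Complex.I * L (Cplx.mk y 0) :=
    fun x y => by
      rw [← smul_eq_mul, ← map_smul, ← map_add]
      congr 1
      ext <;> simp
  have hre : ∀ x : V, (L (Cplx.mk x 0)).re = 0 := fun x => by
    obtain ⟨y, hy⟩ := hC.interior_nonempty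
    have h1 := (hnorm x y hy).trans (hnorm 0 y hy).symm
    rw [hL _ hy, hL _ hy, Complex.norm_exp, Complex.norm_exp, ← Real.exp_nat_mul,
      ← Real.exp_nat_mul, Real.exp_eq_exp, hmk x y, hmk 0 y] at h1
    have h2 : Cplx.mk (0 : V) 0 = 0 := rfl
    rw [h2, map_zero] at h1
    simp only [Complex.add_re, Complex.zero_re] at h1
    push_cast at h1
    linarith
  have hcont : Continuous fun x : V => (L (Cplx.mk x 0)).im :=
    Complex.continuous_im.comp (hLc.comp (continuous_id.prodMk continuous_const))
  let f : WeakDual ℝ V := (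
    { toFun := fun x => (L (Cplx.mk x 0)).im
      map_add' := fun x y => by
        rw [← Complex.add_im, ← map_add]
        congr 2
        ext <;> simp
      map_smul' := fun r x => by
        have : Cplx.mk (r • x) 0 = (r : ℂ) • Cplx.mk x 0 := by
          refine Cplx.ext ?_ ?_
          · rw [Cplx.re_smul]; simp
          · rw [Cplx.im_smul]; simp
        rw [this, map_smul]
        simp
      cont := hcont } : V →L[ℝ] ℝ)
  have hf : ∀ x : V, L (Cplx.mk x 0) = Complex.I * (f x : ℂ) := fun x => by
    apply Complex.ext
    · simp [hre]
    · simp; rfl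
  have hLf : ∀ s : Cplx V, L s = Complex.I * dualExt f s := fun s => by
    have : s = Cplx.mk s.re s.im := rfl
    rw [this, hmk, hf, hf, dualExt]
    simp only [Cplx.re_mk, Cplx.im_mk]
    ring
  refine ⟨f, ?_, fun s hs => by rw [hL s hs, hLf]⟩
  refine mem_of_forall_interior_le hC.nonempty hC.isClosed hC.convex hC.interior_nonempty
    fun y hy => ?_
  have h1 := χ.bounded (Cplx.mk 0 y) hy
  rw [hL _ hy, hLf, norm_exp_dualExt, alphaC, Real.exp_le_exp] at h1
  simpa using h1

end HostTube

/-! ### The isomorphism `C⋆(S, α_C) ≅ C₀(C)` -/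

namespace HostTube

section Gelfand

variable {A : Type v} [NonUnitalCStarAlgebra A]

/-- Gelfand theory for commuting elements of a C⋆-algebra: on the closed subalgebra generated by a
commutative `⋆`-closed set `T` the norm is attained on characters. Characters enter as functionals
on `A` that are multiplicative on `T`, by the Hahn–Banach theorem. -/
theorem norm_le_of_forall_character {T : Set A} (hcomm : ∀ a ∈ T, ∀ b ∈ T, a * b = b * a)
    (hstar : ∀ a ∈ T, star a ∈ T) {x : A} (hx : x ∈ NonUnitalStarAlgebra.adjoin ℂ T) {r : ℝ}
    (hr : 0 ≤ r) (h : ∀ F : A →L[ℂ] ℂ, ‖F‖ ≤ 1 → (∀ a ∈ T, ∀ b ∈ T, F (a * b) = F a * F b) →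
      (∀ a ∈ T, F (star a) = star (F a)) → ‖F x‖ ≤ r) : ‖x‖ ≤ r := by
  set N := NonUnitalStarAlgebra.adjoin ℂ T with hN
  let B := N.topologicalClosure
  have hBclosed : IsClosed (B : Set A) := N.isClosed_topologicalClosure
  have hNcomm : ∀ a b : N, a * b = b * a := by
    have := NonUnitalStarAlgebra.isMulCommutative_adjoin ℂ hcomm
      fun a ha b hb => hcomm a ha _ (hstar b hb)
    exact fun a b => this.is_comm.comm a b
  let : NonUnitalCStarAlgebra B := NonUnitalStarSubalgebra.nonUnitalCStarAlgebra B
  let : NonUnitalCommCStarAlgebra B :=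
    { (inferInstance : NonUnitalCStarAlgebra B) with
      mul_comm := (N.nonUnitalCommRingTopologicalClosure hNcomm).mul_comm }
  have hTB : ∀ a ∈ T, a ∈ B := fun a ha =>
    N.le_topologicalClosure (NonUnitalStarAlgebra.subset_adjoin ℂ _ ha)
  let x' : B := ⟨x, N.le_topologicalClosure hx⟩
  have hx' : ‖(x' : Unitization ℂ B)‖ = ‖x‖ := by
    rw [Unitization.norm_inr]; rfl
  rw [← hx', ← (AddMonoidHomClass.isometry_iff_norm _).1
    (gelfandTransform_isometry (Unitization ℂ B)), ContinuousMap.norm_le _ hr]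
  intro χ
  let F₀ : B →L[ℂ] ℂ := LinearMap.mkContinuous
    { toFun := fun b => χ (b : Unitization ℂ B)
      map_add' := fun a b => by rw [Unitization.inr_add, map_add]
      map_smul' := fun c b => by rw [Unitization.inr_smul, map_smul]; rfl } 1 fun b => by
        rw [one_mul, ← Unitization.norm_inr (𝕜 := ℂ) b]
        exact AlgHom.norm_apply_le_self χ (b : Unitization ℂ B)
  obtain ⟨F, hF, hFn⟩ := exists_extension_norm_eq B.toSubmodule F₀
  have hFχ : ∀ b : B, F b = χ (b : Unitization ℂ B) := fun b => hF b
  have := h F (hFn.trans_le (LinearMap.mkContinuous_norm_le _ zero_le_one _)) ?_ ?_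
  · rwa [show x = ((x' : B) : A) from rfl, hFχ] at this
  · intro a ha b hb
    have e := hFχ (⟨a, hTB a ha⟩ * ⟨b, hTB b hb⟩)
    rw [Unitization.inr_mul, map_mul, ← hFχ, ← hFχ] at e
    exact e
  · intro a ha
    have e := hFχ (star ⟨a, hTB a ha⟩)
    rw [Unitization.inr_star, map_star, ← hFχ] at e
    exact e

end Gelfand

variable {V : Type u} [AddCommGroup V] [Module ℝ V] [TopologicalSpace V]
  [IsTopologicalAddGroup V] [ContinuousSMul ℝ V] {C : Set (WeakDual ℝ V)}

/-- The `C₀(C)`-norm dominates the norm under every `α_C`-bounded holomorphic morphism: the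
characters of the image are evaluations at points of `C`. -/
theorem IsTubeSet.norm_linearCombination_le (hC : IsTubeSet C) {A : Type v}
    [NonUnitalCStarAlgebra A]
    (β : HolMorphism (tube C) (fun s t => s + t) Cplx.inv (alphaC C) A) (c : tube C →₀ ℂ) :
    ‖Finsupp.linearCombination ℂ (fun s : tube C => β.toFun s) c‖ ≤
      ‖Finsupp.linearCombination ℂ (fun s : tube C => expC C s) c‖ := by
  have hmul : ∀ s ∈ tube C, ∀ t ∈ tube C, β.toFun (s + t) = β.toFun s * β.toFun t := β.map_mul
  refine norm_le_of_forall_character (T := β.toFun '' tube C) ?_ ?_ ?_ (norm_nonneg _)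
    fun F hF hFmul hFstar => ?_
  · rintro _ ⟨s, hs, rfl⟩ _ ⟨t, ht, rfl⟩
    rw [← hmul s hs t ht, ← hmul t ht s hs, add_comm]
  · rintro _ ⟨s, hs, rfl⟩
    exact ⟨s.inv, hs, β.map_st s hs⟩
  · rw [Finsupp.linearCombination_apply]
    exact sum_mem fun s _ => SMulMemClass.smul_mem _
      (NonUnitalStarAlgebra.subset_adjoin ℂ _ ⟨s, s.2, rfl⟩)
  · let χ : HolMorphism (tube C) (fun s t => s + t) Cplx.inv (alphaC C) ℂ :=
      { toFun := fun s => F (β.toFun s)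
        map_mul := fun s hs t ht => by
          rw [β.map_mul s hs t ht]
          exact hFmul _ ⟨s, hs, rfl⟩ _ ⟨t, ht, rfl⟩
        map_st := fun s hs => by
          rw [β.map_st s hs]
          exact hFstar _ ⟨s, hs, rfl⟩
        bounded := fun s hs => (F.le_of_opNorm_le hF _).trans
          ((one_mul _).trans_le (β.bounded s hs))
        holomorphic := ⟨fun n => (β.holomorphic.1 n).clm_comp (F.restrictScalars ℝ),
          fun s hs => by
            obtain ⟨L, hL⟩ := β.holomorphic.2 s hs
            exact ⟨F.toLinearMap ∘ₗ L, fun h => (hL h).clm_comp (F.restrictScalars ℝ)⟩⟩ }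
    have hFlc : F (Finsupp.linearCombination ℂ (fun s : tube C => β.toFun s) c) =
        c.sum fun s z => z * χ.toFun s := by
      rw [Finsupp.linearCombination_apply, Finsupp.sum, map_sum]
      simp [χ, Finsupp.sum]
    rw [hFlc]
    by_cases h0 : ∃ s ∈ tube C, χ.toFun s ≠ 0
    · obtain ⟨s₀, hs₀, hne⟩ := h0
      obtain ⟨f, hf, hχ⟩ := hC.exists_mem_of_character χ hs₀ hne
      refine le_trans (le_of_eq ?_) (norm_apply_le_norm _ (⟨f, hf⟩ : C))
      let ev : C₀(C, ℂ) →ₗ[ℂ] ℂ :=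
        { toFun := fun g => g ⟨f, hf⟩, map_add' := fun _ _ => rfl, map_smul' := fun _ _ => rfl }
      congr 1
      change _ = ev _
      rw [Finsupp.linearCombination_apply, Finsupp.sum, Finsupp.sum, map_sum]
      refine Finset.sum_congr rfl fun s _ => ?_
      rw [map_smul, hχ s s.2, smul_eq_mul]
      congr 1
      exact (hC.expC_apply s.2 ⟨f, hf⟩).symm
    · push Not at h0
      have : (c.sum fun s z => z * χ.toFun s) = 0 :=
        Finset.sum_eq_zero fun s _ => by simp only [h0 s s.2, mul_zero]
      rw [this, norm_zero]
      exact norm_nonneg _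

/-- The C⋆-algebra `C₀(C)` with its morphism `γ`, as one of the targets defining `C⋆(S, α_C)`. -/
noncomputable def IsTubeSet.gammaTarget (hC : IsTubeSet C) :
    Target (tube C) (fun s t => s + t) Cplx.inv (alphaC C) :=
  { A := C₀(C, ℂ), hom := hC.gamma }

/-- The projection of `C⋆(S, α_C)` to its component `C₀(C)`. -/
noncomputable def IsTubeSet.proj (hC : IsTubeSet C) :
    semigroupCStar (tube C) (fun s t => s + t) Cplx.inv (alphaC C) →⋆ₙₐ[ℂ] C₀(C, ℂ) where
  toFun x := (x : TargetProd (tube C) (fun s t => s + t) Cplx.inv (alphaC C)) hC.gammaTarget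
  map_smul' _ _ := rfl
  map_zero' := rfl
  map_add' _ _ := rfl
  map_mul' _ _ := rfl
  map_star' _ := rfl

theorem IsTubeSet.proj_etaCStar (hC : IsTubeSet C) (s : tube C) :
    hC.proj (etaCStar (tube C) (fun s t => s + t) Cplx.inv (alphaC C) s) = expC C s := rfl

theorem IsTubeSet.norm_le_norm_proj (hC : IsTubeSet C)
    (x : semigroupCStar (tube C) (fun s t => s + t) Cplx.inv (alphaC C)) :
    ‖x‖ ≤ ‖hC.proj x‖ := by
  let P := TargetProd (tube C) (fun s t => s + t) Cplx.inv (alphaC C)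
  let u : tube C → P := universalMap (tube C) (fun s t => s + t) Cplx.inv (alphaC C)
  have hcl : IsClosed {p : P | ‖p‖ ≤ ‖p hC.gammaTarget‖} := by
    refine isClosed_le continuous_norm (Continuous.norm ?_)
    refine (LipschitzWith.of_dist_le_mul (K := 1) fun p q => ?_).continuous
    rw [NNReal.coe_one, one_mul, dist_eq_norm, dist_eq_norm]
    exact lp.norm_apply_le_norm ENNReal.top_ne_zero (p - q) hC.gammaTarget
  refine closure_minimal (fun p hp => ?_) hcl x.2
  have hspan : p ∈ Submodule.span ℂ (range u) := by
    refine adjoin_le_span ?_ ?_ hp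
    · rintro _ ⟨s, rfl⟩ _ ⟨t, rfl⟩
      refine ⟨⟨s + t, add_mem_tube s.2 (interior_subset t.2)⟩, ?_⟩
      ext i
      exact i.hom.map_mul s s.2 t t.2
    · rintro _ ⟨s, rfl⟩
      refine ⟨⟨(s : Cplx V).inv, s.2⟩, ?_⟩
      ext i
      exact i.hom.map_st s s.2
  obtain ⟨c, rfl⟩ := Finsupp.mem_span_range_iff_exists_finsupp.1 hspan
  have happ : ∀ i : Target (tube C) (fun s t => s + t) Cplx.inv (alphaC C),
      (c.sum fun s z => z • u s : P) i =
        Finsupp.linearCombination ℂ (fun s : tube C => i.hom.toFun s) c := fun i => by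
    let ev : P →ₗ[ℂ] i.A :=
      { toFun := fun p => p i, map_add' := fun _ _ => rfl, map_smul' := fun _ _ => rfl }
    change ev _ = _
    rw [Finsupp.linearCombination_apply, Finsupp.sum, Finsupp.sum, map_sum]
    exact Finset.sum_congr rfl fun s _ => map_smul _ _ _
  refine lp.norm_le_of_forall_le (norm_nonneg _) fun i => ?_
  rw [happ, happ]
  exact hC.norm_linearCombination_le i.hom c

theorem IsTubeSet.isometry_proj (hC : IsTubeSet C) : Isometry hC.proj :=
  AddMonoidHomClass.isometry_of_norm hC.proj fun x =>
    le_antisymm (lp.norm_apply_le_norm ENNReal.top_ne_zero x.1 hC.gammaTarget)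
      (hC.norm_le_norm_proj x)

theorem IsTubeSet.bijective_proj (hC : IsTubeSet C) : Function.Bijective hC.proj := by
  refine ⟨hC.isometry_proj.injective, range_eq_univ.1 ?_⟩
  have : CompleteSpace (semigroupCStar (tube C) (fun s t => s + t) Cplx.inv (alphaC C)) :=
    (NonUnitalStarSubalgebra.isClosed_topologicalClosure _).completeSpace_coe
  have hcl : IsClosed (range hC.proj) := hC.isometry_proj.isClosedEmbedding.isClosed_range
  rw [← hcl.closure_eq]
  refine (hC.dense_span_expC.mono fun g hg => ?_).closure_eq
  let p : semigroupCStar (tube C) (fun s t => s + t) Cplx.inv (alphaC C) →ₗ[ℂ] C₀(C, ℂ) :=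
    { toFun := hC.proj, map_add' := map_add hC.proj, map_smul' := map_smul hC.proj }
  have hle : Submodule.span ℂ (expC C '' tube C) ≤ LinearMap.range p :=
    Submodule.span_le.2 (by
      rintro _ ⟨s, hs, rfl⟩
      exact ⟨etaCStar (tube C) _ _ _ ⟨s, hs⟩, hC.proj_etaCStar ⟨s, hs⟩⟩)
  exact hle hg

end HostTube

/-! ### Non-degenerate representations and multipliers -/

namespace HostTube

section StrongLimit

variable {ι : Type v} {H : Type w} [NormedAddCommGroup H] [NormedSpace ℂ H]

/-- A uniformly bounded family of operators that converges strongly on a total set converges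
strongly to a bounded operator. -/
theorem exists_strong_limit [CompleteSpace H] {l : Filter ι} [l.NeBot] {T : ι → H →L[ℂ] H} {M : ℝ}
    (hT : ∀ᶠ i in l, ‖T i‖ ≤ M) {D : Set H} (hD : Dense (Submodule.span ℂ D : Set H))
    (hlim : ∀ w ∈ D, ∃ x, Tendsto (fun i => T i w) l (𝓝 x)) :
    ∃ S : H →L[ℂ] H, ∀ w, Tendsto (fun i => T i w) l (𝓝 (S w)) := by
  have hM : 0 ≤ M := by
    obtain ⟨i, hi⟩ := hT.exists
    exact (norm_nonneg _).trans hi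
  let K : Submodule ℂ H :=
    { carrier := {w | ∃ x, Tendsto (fun i => T i w) l (𝓝 x)}
      add_mem' := by
        rintro a b ⟨x, hx⟩ ⟨y, hy⟩
        exact ⟨x + y, (hx.add hy).congr fun i => (map_add (T i) a b).symm⟩
      zero_mem' := ⟨0, by simp⟩
      smul_mem' := by
        rintro c a ⟨x, hx⟩
        exact ⟨c • x, (hx.const_smul c).congr fun i => (map_smul (T i) c a).symm⟩ }
  have hK : ∀ w, ∃ x, Tendsto (fun i => T i w) l (𝓝 x) := fun w => by
    suffices h : Cauchy (map (fun i => T i w) l) from CompleteSpace.complete h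
    rw [Metric.cauchy_iff]
    refine ⟨inferInstance, fun ε hε => ?_⟩
    have hKd : Dense (K : Set H) := hD.mono (Submodule.span_le.2 hlim)
    have hδ : 0 < ε / (4 * (M + 1)) := by positivity
    obtain ⟨w', ⟨x, hx⟩, hw'⟩ := hKd.exists_dist_lt w hδ
    refine ⟨Metric.ball x (ε / 2), ?_, fun a ha b hb => ?_⟩
    · have h1 := hx.eventually (Metric.ball_mem_nhds x (by positivity : 0 < ε / 4))
      change ∀ᶠ i in l, T i w ∈ Metric.ball x (ε / 2)
      filter_upwards [hT, h1] with i hi h2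
      have h3 : ‖T i w - T i w'‖ ≤ ε / 4 := by
        rw [← map_sub]
        have h4 : ‖w - w'‖ ≤ ε / (4 * (M + 1)) := by
          rw [← dist_eq_norm]; exact hw'.le
        calc ‖T i (w - w')‖ ≤ (M + 1) * (ε / (4 * (M + 1))) :=
              (T i).le_of_opNorm_le_of_le (by linarith) h4
          _ = ε / 4 := by field_simp
      rw [Metric.mem_ball]
      calc dist (T i w) x ≤ dist (T i w) (T i w') + dist (T i w') x := dist_triangle _ _ _
        _ < ε / 4 + ε / 4 := add_lt_add_of_le_of_lt (by rwa [dist_eq_norm]) h2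
        _ = ε / 2 := by ring
    · calc dist a b ≤ dist a x + dist b x := dist_triangle_right _ _ _
        _ < ε / 2 + ε / 2 := add_lt_add ha hb
        _ = ε := by ring
  choose S hS using hK
  refine ⟨LinearMap.mkContinuous
    { toFun := S
      map_add' := fun a b => tendsto_nhds_unique (hS (a + b))
        (((hS a).add (hS b)).congr fun i => (map_add (T i) a b).symm)
      map_smul' := fun c a => tendsto_nhds_unique (hS (c • a))
        (((hS a).const_smul c).congr fun i => (map_smul (T i) c a).symm) } M fun w => ?_, hS⟩
  exact le_of_tendsto (hS w).norm (hT.mono fun i hi => (T i).le_of_opNorm_le hi w)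

end StrongLimit

section Multiplier

variable {A : Type u} [NonUnitalCStarAlgebra A]

theorem exists_bounded_approximateUnit (A : Type u) [NonUnitalCStarAlgebra A] :
    ∃ l : Filter A, l.NeBot ∧ (∀ a, Tendsto (fun e => e * a) l (𝓝 a)) ∧ ∀ᶠ e in l, ‖e‖ ≤ 1 := by
  let _ : PartialOrder A := CStarAlgebra.spectralOrder A
  have : StarOrderedRing A := CStarAlgebra.spectralOrderedRing A
  have h := CStarAlgebra.increasingApproximateUnit A
  exact ⟨_, h.neBot, h.tendsto_mul_right, h.eventually_norm⟩

theorem multiplier_fst_mul (m : 𝓜(ℂ, A)) (a b : A) : m.fst (a * b) = m.fst a * b := by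
  have h : ∀ z, z * (m.fst (a * b) - m.fst a * b) = 0 := fun z => by
    rw [mul_sub, ← m.central, ← mul_assoc, ← mul_assoc, ← m.central, sub_self]
  exact sub_eq_zero.1 (CStarRing.star_mul_self_eq_zero_iff _ |>.1 (h _))

theorem multiplier_snd_mul (m : 𝓜(ℂ, A)) (a b : A) : m.snd (a * b) = a * m.snd b := by
  have h : ∀ z, (m.snd (a * b) - a * m.snd b) * z = 0 := fun z => by
    rw [sub_mul, m.central, mul_assoc, mul_assoc, m.central, sub_self]
  exact sub_eq_zero.1 (CStarRing.mul_star_self_eq_zero_iff _ |>.1 (h _))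

theorem multiplier_mul_coe (m : 𝓜(ℂ, A)) (a : A) : m * (a : 𝓜(ℂ, A)) = (m.fst a : A) := by
  refine DoubleCentralizer.ext ℂ A _ _ (Prod.ext ?_ ?_) <;> ext b
  · simpa using multiplier_fst_mul m a b
  · simpa using m.central b a

theorem multiplier_coe_mul (m : 𝓜(ℂ, A)) (a : A) : (a : 𝓜(ℂ, A)) * m = (m.snd a : A) := by
  refine DoubleCentralizer.ext ℂ A _ _ (Prod.ext ?_ ?_) <;> ext b
  · simpa using (m.central a b).symm
  · simpa using multiplier_snd_mul m b a

end Multiplier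

section Representation

variable {A : Type u} [NonUnitalCStarAlgebra A] {H : Type w} [NormedAddCommGroup H]
  [InnerProductSpace ℂ H] [CompleteSpace H] {π : A →⋆ₙₐ[ℂ] (H →L[ℂ] H)}

theorem IsMultiplierExtension.apply_fst {ρ : 𝓜(ℂ, A) →⋆ₐ[ℂ] (H →L[ℂ] H)}
    (hρ : IsMultiplierExtension π ρ) (m : 𝓜(ℂ, A)) (a : A) : ρ m * π a = π (m.fst a) := by
  rw [← hρ, ← hρ, ← map_mul, multiplier_mul_coe]

theorem IsMultiplierExtension.apply_snd {ρ : 𝓜(ℂ, A) →⋆ₐ[ℂ] (H →L[ℂ] H)}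
    (hρ : IsMultiplierExtension π ρ) (m : 𝓜(ℂ, A)) (a : A) : π a * ρ m = π (m.snd a) := by
  rw [← hρ, ← hρ, ← map_mul, multiplier_coe_mul]

theorem inner_rep_apply (a : A) (v w : H) : inner ℂ (π a v) w = inner ℂ v (π (star a) w) := by
  rw [map_star, ContinuousLinearMap.star_eq_adjoint, ContinuousLinearMap.adjoint_inner_right]

theorem continuous_rep : Continuous π :=
  AddMonoidHomClass.continuous_of_bound π 1 fun a => by
    rw [one_mul]; exact NonUnitalStarAlgHom.norm_apply_le π a

/-- The vectors `π(a) v`, with `a` in a total subset of `A`, form a total set. -/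
theorem IsNondegenerate.dense_span (hπ : IsNondegenerate π) {D : Set A}
    (hD : Dense (Submodule.span ℂ D : Set A)) :
    Dense (Submodule.span ℂ {w : H | ∃ a ∈ D, ∃ v, π a v = w} : Set H) := by
  set K := Submodule.span ℂ {w : H | ∃ a ∈ D, ∃ v, π a v = w}
  refine Submodule.dense_iff_topologicalClosure_eq_top.2
    (Submodule.topologicalClosure_eq_top_iff.2 ((Submodule.eq_bot_iff _).2 fun w hw => ?_))
  have hz : ∀ (v : H) (a : A), inner ℂ w (π a v) = 0 := fun v => by
    have hc : Continuous fun a : A => inner ℂ w (π a v) :=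
      continuous_const.inner (continuous_rep.clm_apply continuous_const)
    have hspan : ∀ a ∈ Submodule.span ℂ D, inner ℂ w (π a v) = 0 := fun a ha => by
      induction ha using Submodule.span_induction with
      | mem a ha =>
        exact inner_eq_zero_symm.1
          ((Submodule.mem_orthogonal K w).1 hw _ (Submodule.subset_span ⟨a, ha, v, rfl⟩))
      | zero => simp
      | add a b _ _ h1 h2 => rw [map_add, add_apply, inner_add_right, h1, h2, add_zero]
      | smul c a _ h => rw [map_smul, smul_apply, inner_smul_right, h, mul_zero]
    intro a
    exact closure_minimal (t := {a | inner ℂ w (π a v) = 0}) hspan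
      (isClosed_eq hc continuous_const) (hD a)
  refine hπ w fun a => ?_
  rw [← inner_self_eq_zero (𝕜 := ℂ), inner_rep_apply]
  exact hz _ _

theorem IsNondegenerate.ext (hπ : IsNondegenerate π) {S T : H →L[ℂ] H}
    (h : ∀ a, S * π a = T * π a) : S = T := by
  have hd := hπ.dense_span (D := univ) (by simp)
  refine ContinuousLinearMap.ext_on hd ?_
  rintro _ ⟨a, -, v, rfl⟩
  exact congrArg (fun R : H →L[ℂ] H => R v) (h a)

/-- A non-degenerate representation extends to the multiplier algebra: `ρ(m)` is the strong limit of
`π(m e)` along a bounded approximate unit. -/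
theorem IsNondegenerate.exists_extension (hπ : IsNondegenerate π) :
    ∃ ρ : 𝓜(ℂ, A) →⋆ₐ[ℂ] (H →L[ℂ] H), IsMultiplierExtension π ρ := by
  obtain ⟨l, hl, happ, hbd⟩ := exists_bounded_approximateUnit A
  have hex : ∀ m : 𝓜(ℂ, A), ∃ S : H →L[ℂ] H, ∀ a, S * π a = π (m.fst a) := fun m => by
    have hlim : ∀ (a : A) (v : H),
        Tendsto (fun e => π (m.fst e) (π a v)) l (𝓝 (π (m.fst a) v)) := fun a v => by
      have h1 : Continuous fun b : A => π (m.fst b) v :=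
        (continuous_rep.comp m.fst.continuous).clm_apply continuous_const
      refine ((h1.tendsto a).comp (happ a)).congr fun e => ?_
      simp only [Function.comp_apply, multiplier_fst_mul, map_mul]
      rfl
    obtain ⟨S, hS⟩ := exists_strong_limit (T := fun e => π (m.fst e)) (M := ‖m.fst‖) (l := l)
      (hbd.mono fun e he => (NonUnitalStarAlgHom.norm_apply_le π _).trans
        ((m.fst.le_opNorm_of_le he).trans_eq (mul_one _)))
      (hπ.dense_span (D := univ) (by simp))
      (by rintro _ ⟨a, -, v, rfl⟩; exact ⟨_, hlim a v⟩)
    exact ⟨S, fun a => ContinuousLinearMap.ext fun v => tendsto_nhds_unique (hS _) (hlim a v)⟩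
  choose ρ hρ using hex
  have hsnd : ∀ (m : 𝓜(ℂ, A)) (c : A), π c * ρ m = π (m.snd c) := fun m c =>
    hπ.ext fun b => by rw [mul_assoc, hρ, ← map_mul, ← map_mul, m.central]
  refine ⟨
    { toFun := ρ
      map_one' := hπ.ext fun a => by rw [hρ, one_mul]; rfl
      map_mul' := fun m n => hπ.ext fun a => by
        rw [hρ, mul_assoc, hρ, hρ]; rfl
      map_zero' := hπ.ext fun a => by
        rw [hρ, zero_mul, DoubleCentralizer.zero_fst, zero_apply, map_zero]
      map_add' := fun m n => hπ.ext fun a => by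
        rw [hρ, add_mul, hρ, hρ, DoubleCentralizer.add_fst, add_apply, map_add]
      commutes' := fun c => hπ.ext fun a => by
        rw [hρ, DoubleCentralizer.algebraMap_fst, Algebra.algebraMap_eq_smul_one,
          Algebra.algebraMap_eq_smul_one, smul_mul_assoc, one_mul, ← map_smul]
        rfl
      map_star' := fun m => hπ.ext fun a => ?_ }, fun a => hπ.ext fun b => ?_⟩
  · rw [hρ, DoubleCentralizer.star_fst, map_star, ← hsnd, star_mul, map_star, star_star]
  · change ρ _ * _ = _
    rw [hρ, ← map_mul]
    rfl

end Representation

end HostTube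

/-! ### The host algebra property -/

namespace HostTube

section Representation

variable {A : Type u} [NonUnitalCStarAlgebra A] {H : Type w} [NormedAddCommGroup H]
  [InnerProductSpace ℂ H] [CompleteSpace H] {π : A →⋆ₙₐ[ℂ] (H →L[ℂ] H)}

/-- The orbit map `a ↦ π(a) v`. -/
noncomputable def orbitMap (π : A →⋆ₙₐ[ℂ] (H →L[ℂ] H)) (v : H) : A →L[ℂ] H where
  toFun a := π a v
  map_add' a b := by rw [map_add, add_apply]
  map_smul' c a := by rw [map_smul, smul_apply, RingHom.id_apply]
  cont := continuous_rep.clm_apply continuous_const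

theorem IsNondegenerate.eq_zero_of_forall_mem (hπ : IsNondegenerate π) {D : Set A}
    (hD : Dense (Submodule.span ℂ D : Set A)) {v : H} (h : ∀ a ∈ D, π a v = 0) : v = 0 := by
  have : orbitMap π v = 0 := ContinuousLinearMap.ext_on hD h
  exact hπ v fun a => congrArg (fun f : A →L[ℂ] H => f a) this

theorem norm_map_unitary (ρ : 𝓜(ℂ, A) →⋆ₐ[ℂ] (H →L[ℂ] H)) (u : unitary 𝓜(ℂ, A)) (v : H) :
    ‖ρ (u : 𝓜(ℂ, A)) v‖ = ‖v‖ := by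
  have h1 : star (ρ (u : 𝓜(ℂ, A))) * ρ (u : 𝓜(ℂ, A)) = 1 := by
    rw [← map_star, ← map_mul, Unitary.coe_star_mul_self, map_one]
  have h2 : inner ℂ (ρ (u : 𝓜(ℂ, A)) v) (ρ (u : 𝓜(ℂ, A)) v) = inner ℂ v v := by
    rw [← ContinuousLinearMap.adjoint_inner_right, ← ContinuousLinearMap.star_eq_adjoint,
      ← mul_apply_eq_comp, h1, one_apply_eq_self]
  rw [inner_self_eq_norm_sq_to_K, inner_self_eq_norm_sq_to_K] at h2
  have h3 : ‖ρ (u : 𝓜(ℂ, A)) v‖ ^ 2 = ‖v‖ ^ 2 := by exact_mod_cast h2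
  exact (sq_eq_sq₀ (norm_nonneg _) (norm_nonneg _)).1 h3

/-- Strong continuity of a unitary multiplier action in every non-degenerate representation follows
from norm continuity of its orbit maps on a total subset of the algebra. -/
theorem IsNondegenerate.continuous_unitary (hπ : IsNondegenerate π)
    {ρ : 𝓜(ℂ, A) →⋆ₐ[ℂ] (H →L[ℂ] H)} (hρ : IsMultiplierExtension π ρ)
    {G : Type v} [TopologicalSpace G] (η : G → unitary 𝓜(ℂ, A)) {D : Set A}
    (hD : Dense (Submodule.span ℂ D : Set A))
    (hc : ∀ a ∈ D, Continuous fun g => (η g : 𝓜(ℂ, A)).fst a) (v : H) :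
    Continuous fun g => ρ (η g : 𝓜(ℂ, A)) v := by
  refine continuous_iff_continuousAt.2 fun g₀ => ?_
  obtain ⟨S, hS⟩ := exists_strong_limit (l := 𝓝 g₀) (T := fun g => ρ (η g : 𝓜(ℂ, A))) (M := 1)
    (Eventually.of_forall fun g => ContinuousLinearMap.opNorm_le_bound _ zero_le_one fun v => by
      rw [norm_map_unitary, one_mul]) (hπ.dense_span hD) (by
      rintro _ ⟨a, ha, v, rfl⟩
      refine ⟨_, (((continuous_rep (π := π)).comp (hc a ha)).clm_apply
        (continuous_const (y := v))).continuousAt.congr ?_⟩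
      refine Eventually.of_forall fun g => ?_
      exact (congrArg (fun R : H →L[ℂ] H => R v) (hρ.apply_fst (η g : 𝓜(ℂ, A)) a)).symm)
  rw [ContinuousAt, eq_of_tendsto_nhds (hS v)]
  exact hS v

end Representation

section Eta

variable {V : Type u} [AddCommGroup V] [Module ℝ V] [TopologicalSpace V]
  {C : Set (WeakDual ℝ V)}

theorem etaV_fst_apply (x : V) (a : C₀(C, ℂ)) (f : C) :
    ((etaV C (Multiplicative.ofAdd x) : 𝓜(ℂ, C₀(C, ℂ))).fst a) f =
      Complex.exp (Complex.I * ((f : WeakDual ℝ V) x : ℂ)) * a f := by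
  rw [mul_comm Complex.I]
  rfl

theorem etaV_snd (x : V) :
    (etaV C (Multiplicative.ofAdd x) : 𝓜(ℂ, C₀(C, ℂ))).snd =
      (etaV C (Multiplicative.ofAdd x) : 𝓜(ℂ, C₀(C, ℂ))).fst := rfl

theorem add_mk_zero_mem_tube {s : Cplx V} (hs : s ∈ tube C) (x : V) :
    s + Cplx.mk x 0 ∈ tube C := by
  change s.im + 0 ∈ interior (boundedCone C)
  rwa [add_zero]

variable [IsTopologicalAddGroup V] [ContinuousSMul ℝ V]

instance : ContinuousSMul ℂ (Cplx V) where
  continuous_smul := by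
    have hre : Continuous fun p : ℂ × Cplx V => p.2.re := Cplx.continuous_re.comp continuous_snd
    have him : Continuous fun p : ℂ × Cplx V => p.2.im := Cplx.continuous_im.comp continuous_snd
    have cre : Continuous fun p : ℂ × Cplx V => p.1.re := Complex.continuous_re.comp continuous_fst
    have cim : Continuous fun p : ℂ × Cplx V => p.1.im := Complex.continuous_im.comp continuous_fst
    exact ((cre.smul hre).sub (cim.smul him)).prodMk ((cre.smul him).add (cim.smul hre))

namespace IsTubeSet

theorem etaV_fst_expC (hC : IsTubeSet C) {s : Cplx V} (hs : s ∈ tube C) (x : V) :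
    (etaV C (Multiplicative.ofAdd x) : 𝓜(ℂ, C₀(C, ℂ))).fst (expC C s) =
      expC C (s + Cplx.mk x 0) := by
  ext f
  rw [etaV_fst_apply, hC.expC_apply hs, hC.expC_apply (add_mk_zero_mem_tube hs x), dualExt_add,
    mul_add, Complex.exp_add, mul_comm]
  simp [dualExt]

theorem smoothOn_etaV_fst_expC (hC : IsTubeSet C) {s : Cplx V} (hs : s ∈ tube C) :
    SmoothOn (univ : Set V) fun x : V =>
      (etaV C (Multiplicative.ofAdd x) : 𝓜(ℂ, C₀(C, ℂ))).fst (expC C s) := by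
  let T : V →L[ℝ] Cplx V :=
    { toFun := fun x => Cplx.mk x 0
      map_add' := fun x y => by ext <;> simp
      map_smul' := fun r x => by ext <;> simp
      cont := continuous_id.prodMk continuous_const }
  intro n
  have h := (hC.isCn_expC n).1.comp_affine T s (U' := univ) fun x _ => by
    have hx := add_mk_zero_mem_tube hs x
    rw [add_comm] at hx
    exact hx
  convert h using 2 with x
  rw [hC.etaV_fst_expC hs, add_comm]
  rfl

/-- Orbit maps of `η` are smooth on the span of the functions `exp(i f(s))`, since `η(x)` translates
`s` by `x`. -/
theorem smoothOn_etaV_fst (hC : IsTubeSet C) {a : C₀(C, ℂ)}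
    (ha : a ∈ Submodule.span ℂ (expC C '' tube C)) :
    SmoothOn (univ : Set V) fun x : V =>
      (etaV C (Multiplicative.ofAdd x) : 𝓜(ℂ, C₀(C, ℂ))).fst a := by
  intro n
  induction ha using Submodule.span_induction with
  | mem a ha =>
    obtain ⟨s, hs, rfl⟩ := ha
    exact hC.smoothOn_etaV_fst_expC hs n
  | zero =>
    simpa using isCn_clm (n := n) (univ : Set V) (0 : V →L[ℝ] C₀(C, ℂ))
  | add a b _ _ h1 h2 => simpa using h1.add h2
  | smul c a _ h =>
    let T : C₀(C, ℂ) →L[ℝ] C₀(C, ℂ) :=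
      (c • ContinuousLinearMap.id ℂ C₀(C, ℂ)).restrictScalars ℝ
    simpa [T] using h.clm_comp T

theorem isStrictlySmooth_etaV (hC : IsTubeSet C) : IsStrictlySmooth (etaV C) :=
  hC.dense_span_expC.mono fun _ ha => ⟨hC.smoothOn_etaV_fst ha, hC.smoothOn_etaV_fst ha⟩

theorem continuous_etaV_fst_expC (hC : IsTubeSet C) {s : Cplx V} (hs : s ∈ tube C) :
    Continuous fun x : Multiplicative V => (etaV C x : 𝓜(ℂ, C₀(C, ℂ))).fst (expC C s) :=
  continuousOn_univ.1 (hC.smoothOn_etaV_fst_expC hs 0)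

theorem hasDerivAt_expC (hC : IsTubeSet C) {a b : Cplx V} {w : ℂ} (hw : a + w • b ∈ tube C) :
    HasDerivAt (fun w : ℂ => expC C (a + w • b)) (Complex.I • expLinC C (a + w • b) b) w := by
  have hc : Continuous fun w : ℂ => a + w • b := by fun_prop
  refine hasDerivAt_of_pointwise (G := fun w : ℂ => expC C (a + w • b))
    (G' := fun w : ℂ => Complex.I • expLinC C (a + w • b) b) ?_ ?_
  · have hopen : ∀ᶠ z : ℂ in 𝓝 w, ∀ᶠ z' in 𝓝 z, a + z' • b ∈ tube C :=
      (hc.continuousAt.eventually (isOpen_tube.mem_nhds hw)).eventually_nhds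
    filter_upwards [hopen] with z hz f
    set φ := dualExt (f : WeakDual ℝ V) with hφ
    have h1 : HasDerivAt (fun z : ℂ => Complex.exp (Complex.I * (φ a + z * φ b)))
        (Complex.exp (Complex.I * (φ a + z * φ b)) * (Complex.I * (1 * φ b))) z :=
      ((((hasDerivAt_id z).mul_const _).const_add _).const_mul _).cexp
    have h2 : ∀ z : ℂ, φ a + z * φ b = φ (a + z • b) := fun z => by
      rw [hφ, dualExt_add, dualExt_smul]
    simp only [h2] at h1
    refine (h1.congr_of_eventuallyEq ?_).congr_deriv ?_
    · filter_upwards [hz] with z' hz'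
      rw [hC.expC_apply hz']
    · rw [ZeroAtInftyContinuousMap.smul_apply, hC.expLinC_apply hz.self_of_nhds, smul_eq_mul]
      ring
  · have hc' : Continuous fun w : ℂ => (a + w • b, b) := hc.prodMk continuous_const
    have := ContinuousAt.comp (f := fun w : ℂ => (a + w • b, b)) (x := w)
      (g := fun p : Cplx V × Cplx V => expLinC C p.1 p.2)
      (hC.continuousAt_expLinC hw b) hc'.continuousAt
    exact this.const_smul Complex.I

/-- Two representations that agree on `V` intertwine as in the conclusion: the difference of the two
sides extends to a holomorphic function of `w` in the right half-plane, obtained by replacing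
`z = x + i y` by `x + i w y`, which is bounded after multiplication by an exponential and vanishes
on the imaginary axis. -/
theorem rep_mul_eq_of_etaV_eq (hC : IsTubeSet C) {H : Type w} [NormedAddCommGroup H]
    [InnerProductSpace ℂ H] [CompleteSpace H]
    {π₁ π₂ : C₀(C, ℂ) →⋆ₙₐ[ℂ] (H →L[ℂ] H)} {ρ₁ ρ₂ : 𝓜(ℂ, C₀(C, ℂ)) →⋆ₐ[ℂ] (H →L[ℂ] H)}
    (hρ₁ : IsMultiplierExtension π₁ ρ₁) (hρ₂ : IsMultiplierExtension π₂ ρ₂)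
    (h : ∀ g : Multiplicative V,
      ρ₁ (etaV C g : 𝓜(ℂ, C₀(C, ℂ))) = ρ₂ (etaV C g : 𝓜(ℂ, C₀(C, ℂ))))
    {z₁ z₂ z : Cplx V} (hz₁ : z₁ ∈ tube C) (hz₂ : z₂ ∈ tube C) (hz : z ∈ tube C) :
    π₁ (expC C (z₁ + z)) * π₂ (expC C z₂) = π₁ (expC C z₁) * π₂ (expC C (z₂ + z)) := by
  set b := Cplx.mk 0 z.im with hb
  set m := sInf (pairing C z.im) with hm
  let E : Cplx V → ℂ → C₀(C, ℂ) := fun a w => expC C (a + Cplx.mk z.re 0 + w • b)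
  have hmem : ∀ a ∈ tube C, ∀ w : ℂ, 0 ≤ w.re → a + Cplx.mk z.re 0 + w • b ∈ tube C :=
    fun a ha w hw => add_mem_tube (add_mk_zero_mem_tube ha _) (by
      simpa [hb] using smul_mem_boundedCone (interior_subset hz) hw)
  have hE : ∀ a ∈ tube C, ∀ w : ℂ, 0 ≤ w.re → DifferentiableAt ℂ (E a) w := fun a ha w hw =>
    (hC.hasDerivAt_expC (hmem a ha w hw)).differentiableAt
  have hEn : ∀ a ∈ tube C, ∀ w : ℂ, 0 ≤ w.re → ‖Complex.exp (m * w) • E a w‖ ≤ alphaC C a :=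
    fun a ha w hw => by
      have h1 := hC.norm_expC_le (hmem a ha w hw)
      have h2 : (a + Cplx.mk z.re 0 + w • b).im = a.im + w.re • z.im := by simp [hb]
      have h3 := sInf_pairing_add_le hC.nonempty (interior_subset ha)
        (smul_mem_boundedCone (interior_subset hz) hw)
      have h4 := mul_sInf_pairing_le hC.nonempty (interior_subset hz) hw
      rw [norm_smul, Complex.norm_exp]
      calc Real.exp (m * w).re * ‖E a w‖
          ≤ Real.exp (m * w).re * alphaC C (a + Cplx.mk z.re 0 + w • b) := by gcongr
        _ ≤ alphaC C a := by
            rw [alphaC, alphaC, ← Real.exp_add, h2, Real.exp_le_exp, Complex.re_ofReal_mul]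
            linarith
  have hEi : ∀ a ∈ tube C, ∀ t : ℝ, E a (t * Complex.I) =
      (etaV C (Multiplicative.ofAdd (z.re - t • z.im)) : 𝓜(ℂ, C₀(C, ℂ))).fst (expC C a) :=
    fun a ha t => by
      rw [hC.etaV_fst_expC ha]
      simp only [E]
      congr 1
      ext <;> simp [hb, sub_eq_add_neg, add_assoc]
  have hE1 : ∀ a, E a 1 = expC C (a + z) := fun a => by
    simp only [E]
    congr 1
    ext <;> simp [hb]
  let K : ℂ → H →L[ℂ] H := fun w =>
    π₁ (Complex.exp (m * w) • E z₁ w) * π₂ (expC C z₂) -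
      π₁ (expC C z₁) * π₂ (Complex.exp (m * w) • E z₂ w)
  obtain ⟨N, hN⟩ : ∃ N : ℝ, ∀ w : ℂ, 0 ≤ w.re → ‖K w‖ ≤ N := by
    refine ⟨alphaC C z₁ * ‖π₂ (expC C z₂)‖ + ‖π₁ (expC C z₁)‖ * alphaC C z₂, fun w hw => ?_⟩
    refine (norm_sub_le _ _).trans (add_le_add ((norm_mul_le _ _).trans ?_)
      ((norm_mul_le _ _).trans ?_))
    · gcongr
      exact (NonUnitalStarAlgHom.norm_apply_le π₁ _).trans (hEn z₁ hz₁ w hw)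
    · gcongr
      exact (NonUnitalStarAlgHom.norm_apply_le π₂ _).trans (hEn z₂ hz₂ w hw)
  have hKd : DiffContOnCl ℂ K {w : ℂ | 0 < w.re} := by
    refine DifferentiableOn.diffContOnCl fun w hw => DifferentiableAt.differentiableWithinAt ?_
    rw [Complex.closure_setOfPred_lt_re] at hw
    have hexp : DifferentiableAt ℂ (fun w : ℂ => Complex.exp (m * w)) w := by fun_prop
    let P₁ : C₀(C, ℂ) →L[ℂ] (H →L[ℂ] H) :=
      ⟨{ toFun := π₁, map_add' := map_add π₁, map_smul' := map_smul π₁ }, continuous_rep⟩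
    let P₂ : C₀(C, ℂ) →L[ℂ] (H →L[ℂ] H) :=
      ⟨{ toFun := π₂, map_add' := map_add π₂, map_smul' := map_smul π₂ }, continuous_rep⟩
    exact ((P₁.differentiableAt.comp w (hexp.smul (hE z₁ hz₁ w hw))).mul_const _).sub
      ((P₂.differentiableAt.comp w (hexp.smul (hE z₂ hz₂ w hw))).const_mul _)
  have hK1 := PhragmenLindelof.right_half_plane_of_bounded_on_real (C := 0) (z := 1) hKd
    ⟨1, by norm_num, 0, Asymptotics.IsBigO.of_bound N (by
      refine (eventually_inf_principal.2 (Eventually.of_forall fun w hw => ?_))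
      simpa using hN w (le_of_lt hw))⟩
    (isBoundedUnder_of_eventually_le (a := N) (by
      filter_upwards [eventually_ge_atTop 0] with x hx
      exact hN x (by simpa using hx)))
    (fun t => by
      refine (norm_eq_zero.2 ?_).le
      simp only [K]
      rw [hEi z₁ hz₁, hEi z₂ hz₂, ← etaV_snd, map_smul, map_smul, ← hρ₁.apply_snd, etaV_snd,
        ← hρ₂.apply_fst, h, smul_mul_assoc, mul_smul_comm, mul_assoc, sub_self])
    (by simp)
  have hK1' : K 1 = 0 := norm_le_zero_iff.1 hK1
  simp only [K, hE1, map_smul, smul_mul_assoc, mul_smul_comm, ← smul_sub] at hK1'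
  exact sub_eq_zero.1 ((smul_eq_zero_iff_right (Complex.exp_ne_zero _)).1 hK1')

theorem isHostAlgebra_etaV (hC : IsTubeSet C) : IsHostAlgebra.{u, u, w} (etaV C) := by
  refine ⟨fun H _ _ _ π hπ => ?_, fun H _ _ _ π₁ π₂ ρ₁ ρ₂ h₁ h₂ hρ₁ hρ₂ h => ?_⟩
  · obtain ⟨ρ, hρ⟩ := hπ.exists_extension
    exact ⟨ρ, hρ, hπ.continuous_unitary hρ _ hC.dense_span_expC
      (by rintro _ ⟨s, hs, rfl⟩; exact hC.continuous_etaV_fst_expC hs)⟩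
  · have key : ∀ z ∈ tube C, π₁ (expC C z) = π₂ (expC C z) := fun z hz => by
      refine ContinuousLinearMap.ext_on (h₂.dense_span hC.dense_span_expC) ?_
      rintro _ ⟨_, ⟨z₂, hz₂, rfl⟩, v, rfl⟩
      refine sub_eq_zero.1 (h₁.eq_zero_of_forall_mem hC.dense_span_expC ?_)
      rintro _ ⟨z₁, hz₁, rfl⟩
      have h3 := hC.rep_mul_eq_of_etaV_eq hρ₁ hρ₂ h hz₁ hz₂ hz
      rw [hC.expC_add hz₁ hz, add_comm z₂, hC.expC_add hz hz₂, map_mul, map_mul] at h3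
      rw [map_sub, sub_eq_zero]
      exact congrArg (fun R : H →L[ℂ] H => R v) h3
    ext a v
    refine congrArg (fun f : C₀(C, ℂ) →L[ℂ] H => f a)
      (ContinuousLinearMap.ext_on (f := orbitMap π₁ v) (g := orbitMap π₂ v)
        hC.dense_span_expC ?_)
    rintro _ ⟨z, hz, rfl⟩
    exact congrArg (fun R : H →L[ℂ] H => R v) (key z hz)

end IsTubeSet

end Eta

end HostTube

/-! ### The momentum set -/

namespace HostTube

section Evaluation

/-- The representation of `C₀(K)` on `H` by the scalars `a(x)`. -/
noncomputable def scalarRep {K : Type u} [TopologicalSpace K] (x : K) (H : Type w)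
    [NormedAddCommGroup H] [InnerProductSpace ℂ H] [CompleteSpace H] :
    C₀(K, ℂ) →⋆ₙₐ[ℂ] (H →L[ℂ] H) where
  toFun a := a x • 1
  map_smul' c a := by simp [mul_smul]
  map_zero' := by simp
  map_add' a b := by simp [add_smul]
  map_mul' a b := by rw [smul_mul_smul_comm, one_mul]; rfl
  map_star' a := by simp

variable {V : Type u} [AddCommGroup V] [Module ℝ V] [TopologicalSpace V]
  {C : Set (WeakDual ℝ V)}

theorem hasDirDeriv_exp_dual (f : V →L[ℝ] ℝ) (x h : V) :
    HasDirDeriv (fun x : V => Complex.exp (Complex.I * (f x : ℂ))) x h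
      (Complex.exp (Complex.I * (f x : ℂ)) * (Complex.I * (f h : ℂ))) := by
  have h1 : HasDerivAt (fun t : ℝ => Complex.exp (Complex.I * ((f x : ℂ) + t * (f h : ℂ))))
      (Complex.exp (Complex.I * ((f x : ℂ) + (0 : ℝ) * (f h : ℂ))) *
        (Complex.I * (1 * (f h : ℂ)))) 0 :=
    ((((Complex.ofRealCLM.hasDerivAt (x := 0)).mul_const _).const_add _).const_mul _).cexp
  rw [hasDerivAt_iff_tendsto_slope_zero] at h1
  simpa [HasDirDeriv] using h1

theorem hasDirDeriv_exp_dual_zero (f : V →L[ℝ] ℝ) (h : V) :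
    HasDirDeriv (fun x : V => Complex.exp (Complex.I * (f x : ℂ))) 0 h
      (Complex.I * (f h : ℂ)) := by
  have h0 : Complex.exp (Complex.I * (f 0 : ℂ)) * (Complex.I * (f h : ℂ)) =
      Complex.I * (f h : ℂ) := by
    rw [map_zero]; simp
  rw [← h0]
  exact hasDirDeriv_exp_dual f 0 h

variable [IsTopologicalAddGroup V]

theorem smoothOn_exp_dual (f : V →L[ℝ] ℝ) :
    SmoothOn (univ : Set V) (fun x : V => Complex.exp (Complex.I * (f x : ℂ))) := by
  have hc : Continuous fun x : V => Complex.exp (Complex.I * (f x : ℂ)) := by fun_prop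
  intro n
  induction n with
  | zero => exact hc.continuousOn
  | succ n ih =>
    refine ⟨hc.continuousOn, fun p => Complex.exp (Complex.I * (f p.1 : ℂ)) *
      (Complex.I * (f p.2 : ℂ)), fun x _ h => hasDirDeriv_exp_dual f x h, ?_⟩
    let T : V × V →L[ℝ] ℂ := ((Complex.I • ContinuousLinearMap.id ℂ ℂ).restrictScalars ℝ).comp
      (Complex.ofRealCLM.comp (f.comp (ContinuousLinearMap.snd ℝ V V)))
    have h1 := ih.comp_affine (ContinuousLinearMap.fst ℝ V V) 0
      (U' := (univ : Set V) ×ˢ (univ : Set V)) fun _ _ => mem_univ _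
    have h2 := IsCn.mul h1 (isCn_clm (n := n) ((univ : Set V) ×ˢ (univ : Set V)) T)
    simpa [T] using h2

variable [ContinuousSMul ℝ V]

/-- The point evaluation at `f ∈ C` is a state with momentum `f`. -/
theorem IsTubeSet.subset_momentumImage (hC : IsTubeSet C) : C ⊆ momentumImage (etaV C) := by
  intro f hf
  let f' : C := ⟨f, hf⟩
  obtain ⟨y, hy⟩ := hC.interior_nonempty
  have hs : Cplx.mk 0 y ∈ tube C := hy
  set a := expC C (Cplx.mk 0 y) with ha
  have hane : a f' ≠ 0 := by
    rw [ha, hC.expC_apply hs]; exact Complex.exp_ne_zero _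
  let H := EuclideanSpace ℂ PUnit.{u + 1}
  let v : H := EuclideanSpace.single PUnit.unit 1
  have hv : ‖v‖ = 1 := (PiLp.norm_single 2 (fun _ => ℂ) PUnit.unit (1 : ℂ)).trans norm_one
  let π : C₀(C, ℂ) →⋆ₙₐ[ℂ] (H →L[ℂ] H) := scalarRep f' H
  have hπa : ∀ (b : C₀(C, ℂ)) (w : H), π b w = b f' • w := fun b w => rfl
  have hπ : IsNondegenerate π := fun w hw => (smul_eq_zero_iff_right hane).1 (hw a)
  obtain ⟨ρ, hρ⟩ := hπ.exists_extension
  have hρv : ∀ x : V, ρ (etaV C (Multiplicative.ofAdd x) : 𝓜(ℂ, C₀(C, ℂ))) v =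
      Complex.exp (Complex.I * (f x : ℂ)) • v := fun x => by
    have h := congrArg (fun R : H →L[ℂ] H => R v)
      (hρ.apply_fst (etaV C (Multiplicative.ofAdd x) : 𝓜(ℂ, C₀(C, ℂ))) a)
    simp only [mul_apply_eq_comp, hπa, etaV_fst_apply, map_smul] at h
    rw [mul_comm, mul_smul] at h
    exact smul_right_injective H hane h
  let φ : C₀(C, ℂ) →L[ℂ] ℂ := LinearMap.mkContinuous
    { toFun := fun b => b f', map_add' := fun _ _ => rfl, map_smul' := fun _ _ => rfl } 1
    fun b => by rw [one_mul]; exact norm_apply_le_norm b f'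
  have hφ : ∀ b, φ b = b f' := fun _ => rfl
  have hinner : ∀ z : ℂ, inner ℂ v (z • v) = z := fun z => by
    rw [inner_smul_right, inner_self_eq_norm_sq_to_K, hv]; simp
  have hψ : ∀ x : V, inner ℂ v (ρ (etaV C (Multiplicative.ofAdd x) : 𝓜(ℂ, C₀(C, ℂ))) v) =
      Complex.exp (Complex.I * (f x : ℂ)) := fun x => by rw [hρv, hinner]
  refine ⟨φ, fun m => inner ℂ v (ρ m v), ⟨?_, fun b => ?_⟩,
    ⟨H, inferInstance, inferInstance, inferInstance, π, ρ, v, hπ, hρ, hv,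
      fun b => by rw [hπa, hinner, hφ], fun m => rfl⟩, ?_, fun x => ?_⟩
  · refine le_antisymm (LinearMap.mkContinuous_norm_le _ zero_le_one _) ?_
    obtain ⟨l, hl, happ, hbd⟩ := exists_bounded_approximateUnit C₀(C, ℂ)
    have h1 := ((φ.continuous.tendsto a).comp (happ a)).norm
    have h2 : ‖φ a‖ ≤ ‖φ‖ * ‖φ a‖ := le_of_tendsto h1 (hbd.mono fun e he => by
      have h3 : φ (e * a) = φ e * φ a := rfl
      simp only [Function.comp_apply]
      rw [h3, norm_mul]
      gcongr
      exact (φ.le_opNorm_of_le he).trans_eq (mul_one _))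
    have h4 : 0 < ‖φ a‖ := norm_pos_iff.2 hane
    exact (le_mul_iff_one_le_left h4).1 h2
  · have h1 : φ (star b * b) = ((Complex.normSq (b f') : ℝ) : ℂ) := by
      rw [Complex.normSq_eq_conj_mul_self]; rfl
    rw [h1]
    exact ⟨Complex.normSq_nonneg _, Complex.ofReal_im _⟩
  · simp only [hψ]
    exact smoothOn_exp_dual f
  · simp only [hψ]
    exact hasDirDeriv_exp_dual_zero f x

end Evaluation

section Estimates

/-- A function with vanishing first derivative at `0` that is twice differentiable there deviates
from its value at `0` by `O(t²)`. -/
theorem exists_abs_sub_le_mul_sq {r g : ℝ → ℝ} {y : ℝ} (hr : ∀ t, HasDerivAt r (g t) t)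
    (hg : HasDerivAt g y 0) (hg0 : g 0 = 0) :
    ∃ K : ℝ, 0 ≤ K ∧ ∀ᶠ t in 𝓝 (0 : ℝ), |r t - r 0| ≤ K * t ^ 2 := by
  obtain ⟨K, hK, hb⟩ := hg.isBigO_sub.exists_pos
  obtain ⟨δ, hδ, hball⟩ := Metric.eventually_nhds_iff_ball.1 hb.bound
  refine ⟨K, hK.le, ?_⟩
  filter_upwards [Metric.ball_mem_nhds (0 : ℝ) hδ] with t ht
  have ht' : |t| < δ := by simpa using ht
  have := (convex_closedBall (0 : ℝ) |t|).norm_image_sub_le_of_norm_hasDerivWithin_le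
    (f := r) (f' := g) (C := K * |t|) (x := 0) (y := t)
    (fun x _ => (hr x).hasDerivWithinAt) (fun x hx => by
      have hx' : |x| ≤ |t| := by simpa using hx
      have h1 := hball x (by simpa using hx'.trans_lt ht')
      rw [hg0, sub_zero, sub_zero] at h1
      exact h1.trans (mul_le_mul_of_nonneg_left hx' hK.le)) (by simp) (by simp)
  rw [Real.norm_eq_abs, Real.norm_eq_abs, sub_zero, mul_assoc, abs_mul_abs_self] at this
  rwa [sq]

variable {A : Type u} [NonUnitalCStarAlgebra A] {H : Type w} [NormedAddCommGroup H]
  [InnerProductSpace ℂ H] [CompleteSpace H] {π : A →⋆ₙₐ[ℂ] (H →L[ℂ] H)}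

/-- Replacing `ξ` by `π(a) ξ` in `⟨ξ, (U - 1) ξ⟩`, for a unitary multiplier `U` that commutes with
`a`, costs only a multiple of `‖U ξ - ξ‖ ‖ξ - π(a) ξ‖`. -/
theorem norm_inner_sub_inner_le {ρ : 𝓜(ℂ, A) →⋆ₐ[ℂ] (H →L[ℂ] H)}
    (hρ : IsMultiplierExtension π ρ) (u : unitary 𝓜(ℂ, A)) {a : A}
    (ha : (u : 𝓜(ℂ, A)).fst a = (u : 𝓜(ℂ, A)).snd a) (ξ : H) :
    ‖inner ℂ ξ (ρ (u : 𝓜(ℂ, A)) ξ - ξ) -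
        inner ℂ (π a ξ) (ρ (u : 𝓜(ℂ, A)) (π a ξ) - π a ξ)‖ ≤
      (1 + ‖a‖) * (‖ρ (u : 𝓜(ℂ, A)) ξ - ξ‖ * ‖ξ - π a ξ‖) := by
  set U := ρ (u : 𝓜(ℂ, A)) with hU
  have hUP : U * π a = π a * U := by rw [hU, hρ.apply_fst, hρ.apply_snd, ha]
  have hU1 : star U * U = 1 := by
    rw [hU, ← map_star, ← map_mul, Unitary.coe_star_mul_self, map_one]
  have hU2 : U * star U = 1 := by
    rw [hU, ← map_star, ← map_mul, (Unitary.mem_iff.1 u.2).2, map_one]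
  have hUP' : star U * π a = π a * star U := by
    calc star U * π a = star U * (π a * U) * star U := by
          rw [mul_assoc, mul_assoc, hU2, mul_one]
      _ = π a * star U := by rw [← hUP, ← mul_assoc, hU1, one_mul]
  have hUn : ∀ w, ‖star U w‖ = ‖w‖ := fun w => by
    have := norm_map_unitary ρ (star u) w
    rwa [Unitary.coe_star, map_star] at this
  have h1 : ‖star U (π a ξ) - π a ξ‖ ≤ ‖a‖ * ‖U ξ - ξ‖ := by
    have e1 : star U (π a ξ) = π a (star U ξ) := congrArg (fun R : H →L[ℂ] H => R ξ) hUP'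
    have e2 : star U (U ξ) = ξ := congrArg (fun R : H →L[ℂ] H => R ξ) hU1
    have e3 : ‖star U ξ - ξ‖ = ‖U ξ - ξ‖ := by
      rw [← hUn (U ξ - ξ), map_sub, e2, norm_sub_rev]
    rw [e1, ← map_sub, ← e3]
    exact (π a).le_of_opNorm_le (NonUnitalStarAlgHom.norm_apply_le π a) _
  have h2 : inner ℂ ξ (U ξ - ξ) - inner ℂ (π a ξ) (U (π a ξ) - π a ξ) =
      inner ℂ (ξ - π a ξ) (U ξ - ξ) + inner ℂ (star U (π a ξ) - π a ξ) (ξ - π a ξ) := by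
    have e : ∀ w, inner ℂ (star U (π a ξ)) w = inner ℂ (π a ξ) (U w) := fun w => by
      rw [ContinuousLinearMap.star_eq_adjoint, ContinuousLinearMap.adjoint_inner_left]
    simp only [inner_sub_left, inner_sub_right, e]
    ring
  rw [h2]
  calc _ ≤ ‖ξ - π a ξ‖ * ‖U ξ - ξ‖ + ‖a‖ * ‖U ξ - ξ‖ * ‖ξ - π a ξ‖ :=
        (norm_add_le _ _).trans (add_le_add (norm_inner_le_norm _ _)
          ((norm_inner_le_norm _ _).trans (by gcongr)))
    _ = _ := by ring

/-- In a non-degenerate representation every vector is nearly fixed by some `a` with `‖a‖ ≤ 2` from a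
given dense set. -/
theorem IsNondegenerate.exists_norm_sub_lt (hπ : IsNondegenerate π) {D : Set A} (hD : Dense D)
    (ξ : H) {ε : ℝ} (hε : 0 < ε) : ∃ a ∈ D, ‖a‖ ≤ 2 ∧ ‖ξ - π a ξ‖ < ε := by
  obtain ⟨l, hl, happ, hbd⟩ := exists_bounded_approximateUnit A
  have hlim : ∀ (a : A) (v : H), Tendsto (fun e => π e (π a v)) l (𝓝 (π a v)) := fun a v => by
    refine (((continuous_rep (π := π)).clm_apply (continuous_const (y := v))).tendsto a |>.comp
      (happ a)).congr fun e => ?_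
    simp only [Function.comp_apply, map_mul]
    rfl
  obtain ⟨S, hS⟩ := exists_strong_limit (T := fun e => π e) (M := 1) (l := l)
    (hbd.mono fun e he => (NonUnitalStarAlgHom.norm_apply_le π _).trans he)
    (hπ.dense_span (D := univ) (by simp))
    (by rintro _ ⟨a, -, v, rfl⟩; exact ⟨_, hlim a v⟩)
  have hS1 : S = 1 := hπ.ext fun a => ContinuousLinearMap.ext fun v =>
    tendsto_nhds_unique (hS _) (hlim a v)
  have h1 := hS ξ
  rw [hS1, one_apply_eq_self] at h1
  obtain ⟨e, he, hen⟩ := ((h1.eventually (Metric.ball_mem_nhds ξ (half_pos hε))).and hbd).exists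
  set δ := min 1 (ε / (2 * (‖ξ‖ + 1))) with hδ
  have hδ0 : 0 < δ := lt_min one_pos (by positivity)
  obtain ⟨a, haD, ha⟩ := hD.exists_dist_lt e hδ0
  rw [dist_eq_norm] at ha
  refine ⟨a, haD, ?_, ?_⟩
  · have h2 : ‖a‖ ≤ ‖e‖ + ‖e - a‖ := norm_le_norm_add_norm_sub e a
    linarith [ha.le.trans (min_le_left _ _)]
  · have h3 : ‖π e ξ - π a ξ‖ ≤ ε / 2 := by
      have h4 : ‖π (e - a)‖ ≤ ε / (2 * (‖ξ‖ + 1)) :=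
        (NonUnitalStarAlgHom.norm_apply_le π _).trans (ha.le.trans (min_le_right _ _))
      have h5 : π e ξ - π a ξ = π (e - a) ξ := by rw [map_sub]; rfl
      rw [h5]
      calc ‖π (e - a) ξ‖ ≤ ε / (2 * (‖ξ‖ + 1)) * (‖ξ‖ + 1) :=
            (π (e - a)).le_of_opNorm_le_of_le h4 (by linarith)
        _ = ε / 2 := by field_simp
    have h6 : ‖ξ - π e ξ‖ < ε / 2 := by
      rw [← dist_eq_norm, dist_comm]; exact he
    calc ‖ξ - π a ξ‖ = ‖(ξ - π e ξ) + (π e ξ - π a ξ)‖ := by congr 1; abel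
      _ ≤ ‖ξ - π e ξ‖ + ‖π e ξ - π a ξ‖ := norm_add_le _ _
      _ < ε := by linarith

theorem inner_rep_re_nonneg {K : Type u} [TopologicalSpace K] {H : Type w}
    [NormedAddCommGroup H] [InnerProductSpace ℂ H] [CompleteSpace H]
    (π : C₀(K, ℂ) →⋆ₙₐ[ℂ] (H →L[ℂ] H)) {k : C₀(K, ℂ)} {r : K → ℝ} (hr : ∀ x, 0 ≤ r x)
    (hk : ∀ x, k x = r x) (ξ : H) : 0 ≤ (inner ℂ ξ (π k ξ)).re := by
  have hre : ∀ x, r x = (k x).re := fun x => by rw [hk, Complex.ofReal_re]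
  have hrc : Continuous fun x => ((Real.sqrt (k x).re : ℝ) : ℂ) := by fun_prop
  have hr0 : Tendsto (fun x => ((Real.sqrt (k x).re : ℝ) : ℂ)) (cocompact K) (𝓝 0) := by
    have h1 : Continuous fun z : ℂ => ((Real.sqrt z.re : ℝ) : ℂ) := by fun_prop
    simpa [Function.comp_def] using (h1.tendsto 0).comp k.zero_at_infty'
  set q := mkC0 fun x => ((Real.sqrt (k x).re : ℝ) : ℂ) with hq
  have hkq : k = star q * q := by
    ext x
    rw [ZeroAtInftyContinuousMap.mul_apply, ZeroAtInftyContinuousMap.star_apply, hq,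
      mkC0_apply hrc hr0, ← hre, hk]
    simp only [RCLike.star_def, Complex.conj_ofReal]
    rw [← Complex.ofReal_mul, Real.mul_self_sqrt (hr x)]
  rw [hkq, map_mul, mul_apply_eq_comp, ← inner_rep_apply]
  exact inner_self_nonneg (𝕜 := ℂ)

end Estimates

end HostTube

namespace HostTube

section Slopes

variable {A : Type u} [NonUnitalCStarAlgebra A] {H : Type w} [NormedAddCommGroup H]
  [InnerProductSpace ℂ H] [CompleteSpace H] {π : A →⋆ₙₐ[ℂ] (H →L[ℂ] H)}
  {ρ : 𝓜(ℂ, A) →⋆ₐ[ℂ] (H →L[ℂ] H)}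

theorem tendsto_slope_inner_rep (hρ : IsMultiplierExtension π ρ) (ξ : H) {m : ℝ → 𝓜(ℂ, A)}
    {a b : A} (hlim : Tendsto (fun t : ℝ => t⁻¹ • ((m t).fst a - a)) (𝓝[≠] 0) (𝓝 b)) :
    Tendsto (fun t : ℝ => t⁻¹ • (inner ℂ (π a ξ) (ρ (m t) (π a ξ) - π a ξ) : ℂ)) (𝓝[≠] 0)
      (𝓝 (inner ℂ (π a ξ) (π b ξ))) := by
  have hc : Continuous fun g : A => (inner ℂ (π a ξ) (orbitMap π ξ g) : ℂ) :=
    continuous_const.inner (orbitMap π ξ).continuous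
  refine ((hc.tendsto b).comp hlim).congr fun t => ?_
  have e1 : ρ (m t) (π a ξ) - π a ξ = orbitMap π ξ ((m t).fst a - a) := by
    rw [map_sub]
    exact congrArg (fun w => w - π a ξ) (congrArg (fun R : H →L[ℂ] H => R ξ) (hρ.apply_fst _ a))
  rw [Function.comp_apply, e1, ← inner_smul_right_eq_smul]
  exact congrArg (inner ℂ (π a ξ)) (((orbitMap π ξ).restrictScalars ℝ).map_smul t⁻¹ _)

/-- If `⟨ξ, U(t) ξ⟩` has derivative `d` at `t = 0` and the orbit of `ξ` is Lipschitz there, then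
`d` differs from the corresponding derivative at `π(a) ξ` by a multiple of `‖ξ - π(a) ξ‖`. -/
theorem norm_sub_inner_rep_le (hρ : IsMultiplierExtension π ρ) {ξ : H} {m : ℝ → unitary 𝓜(ℂ, A)}
    {M : ℝ} {d : ℂ}
    (hMt : ∀ᶠ t in 𝓝 (0 : ℝ), ‖ρ (m t : 𝓜(ℂ, A)) ξ - ξ‖ ≤ M * |t|)
    (hd : Tendsto (fun t : ℝ => t⁻¹ • (inner ℂ ξ (ρ (m t : 𝓜(ℂ, A)) ξ - ξ) : ℂ)) (𝓝[≠] 0) (𝓝 d))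
    {a b : A} (ha : ‖a‖ ≤ 2) (hcomm : ∀ t, (m t : 𝓜(ℂ, A)).fst a = (m t : 𝓜(ℂ, A)).snd a)
    (hlim : Tendsto (fun t : ℝ => t⁻¹ • ((m t : 𝓜(ℂ, A)).fst a - a)) (𝓝[≠] 0) (𝓝 b)) :
    ‖d - inner ℂ (π a ξ) (π b ξ)‖ ≤ 3 * M * ‖ξ - π a ξ‖ := by
  refine le_of_tendsto (hd.sub (tendsto_slope_inner_rep hρ ξ hlim)).norm ?_
  filter_upwards [nhdsWithin_le_nhds hMt, self_mem_nhdsWithin] with t ht ht0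
  have ht0' : 0 < |t| := abs_pos.2 ht0
  have h4 := norm_inner_sub_inner_le hρ (m t) (hcomm t) ξ
  rw [← smul_sub, norm_smul, norm_inv, Real.norm_eq_abs, inv_mul_le_iff₀ ht0']
  calc _ ≤ _ := h4
    _ ≤ (1 + 2) * (M * |t| * ‖ξ - π a ξ‖) := by gcongr
    _ = _ := by ring

end Slopes

section Momentum

variable {V : Type u} [AddCommGroup V] [Module ℝ V] [TopologicalSpace V]
  {C : Set (WeakDual ℝ V)}

/-- If the matrix coefficient of a unit vector `ξ` is smooth with momentum `l`, then the orbit of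
`ξ` in each direction is Lipschitz at the origin, because
`‖U(t) ξ - ξ‖² = 2 (1 - Re ⟨ξ, U(t) ξ⟩)` is `O(t²)`. -/
theorem exists_norm_unitary_sub_le {A : Type u} [NonUnitalCStarAlgebra A] {H : Type w}
    [NormedAddCommGroup H] [InnerProductSpace ℂ H] [CompleteSpace H]
    (η : Multiplicative V →* unitary 𝓜(ℂ, A)) (ρ : 𝓜(ℂ, A) →⋆ₐ[ℂ] (H →L[ℂ] H)) {ξ : H}
    (hξ : ‖ξ‖ = 1) {l : V → ℝ}
    (hs : SmoothOn (univ : Set V)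
      fun x : V => inner ℂ ξ (ρ (η (Multiplicative.ofAdd x) : 𝓜(ℂ, A)) ξ))
    (hd : ∀ x : V, HasDirDeriv
      (fun x : V => inner ℂ ξ (ρ (η (Multiplicative.ofAdd x) : 𝓜(ℂ, A)) ξ)) 0 x
      (Complex.I * (l x : ℂ))) (v : V) :
    ∃ M : ℝ, 0 ≤ M ∧ ∀ᶠ t in 𝓝 (0 : ℝ),
      ‖ρ (η (Multiplicative.ofAdd (t • v)) : 𝓜(ℂ, A)) ξ - ξ‖ ≤ M * |t| := by
  set Ψ : V → ℂ := fun x => inner ℂ ξ (ρ (η (Multiplicative.ofAdd x) : 𝓜(ℂ, A)) ξ) with hΨ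
  obtain ⟨-, df, hdf, -, ddf, hddf, -⟩ := hs 2
  have hr : ∀ t : ℝ, HasDerivAt (fun t : ℝ => (Ψ (t • v)).re) (df (t • v, v)).re t := fun t => by
    have h1 : HasDerivAt (fun t : ℝ => Ψ (t • v)) (df (t • v, v)) t := by
      rw [hasDerivAt_iff_tendsto_slope_zero]
      refine (hdf (t • v) (mem_univ _) v).congr fun s => ?_
      rw [add_smul]
    exact (Complex.reCLM.hasFDerivAt.comp_hasDerivAt t h1)
  have hg : HasDerivAt (fun t : ℝ => (df (t • v, v)).re) (ddf ((0, v), (v, 0))).re 0 := by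
    have h1 : HasDerivAt (fun t : ℝ => df (t • v, v)) (ddf ((0, v), (v, 0))) 0 := by
      rw [hasDerivAt_iff_tendsto_slope_zero]
      refine (hddf (0, v) ⟨mem_univ _, mem_univ _⟩ (v, 0)).congr fun s => ?_
      simp
    exact (Complex.reCLM.hasFDerivAt.comp_hasDerivAt 0 h1)
  have hg0 : (df ((0 : ℝ) • v, v)).re = 0 := by
    rw [zero_smul, tendsto_nhds_unique (hdf 0 (mem_univ _) v) (hd v)]
    simp
  obtain ⟨K, hK, hev⟩ := exists_abs_sub_le_mul_sq hr hg hg0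
  refine ⟨Real.sqrt (2 * K), Real.sqrt_nonneg _, hev.mono fun t ht => ?_⟩
  set U := ρ (η (Multiplicative.ofAdd (t • v)) : 𝓜(ℂ, A)) with hU
  have hΨ0 : (Ψ ((0 : ℝ) • v)).re = 1 := by
    have h1 : Ψ ((0 : ℝ) • v) = inner ℂ ξ ξ := by
      simp only [hΨ, zero_smul, ofAdd_zero, map_one, OneMemClass.coe_one]
      rfl
    rw [h1, inner_self_eq_norm_sq_to_K, hξ]
    simp
  have h2 : ‖U ξ - ξ‖ ^ 2 = 2 * (1 - (Ψ (t • v)).re) := by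
    rw [norm_sub_sq (𝕜 := ℂ), norm_map_unitary, hξ, inner_re_symm (𝕜 := ℂ)]
    change 1 ^ 2 - 2 * (Ψ (t • v)).re + 1 ^ 2 = _
    ring
  rw [hΨ0, abs_sub_comm] at ht
  refine le_of_sq_le_sq ?_ (by positivity)
  rw [h2, mul_pow, Real.sq_sqrt (by positivity), sq_abs]
  linarith [le_abs_self (1 - (Ψ (t • v)).re)]

/-- Positivity of the vector functionals of `π` at the function `f ↦ (f(v) - c) |a(f)|²`. -/
theorem mul_norm_sq_le_im_inner {H : Type w} [NormedAddCommGroup H] [InnerProductSpace ℂ H]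
    [CompleteSpace H] (π : C₀(C, ℂ) →⋆ₙₐ[ℂ] (H →L[ℂ] H)) {a b : C₀(C, ℂ)} {v : V} {c : ℝ}
    (hv : ∀ f ∈ C, c ≤ f v)
    (hb : ∀ f : C, b f = Complex.I * ((f : WeakDual ℝ V) v : ℂ) * a f) (ξ : H) :
    c * ‖π a ξ‖ ^ 2 ≤ (inner ℂ (π a ξ) (π b ξ)).im := by
  have h1 := inner_rep_re_nonneg π
    (k := (-Complex.I) • (star a * b) - (c : ℂ) • (star a * a))
    (r := fun f : C => ((f : WeakDual ℝ V) v - c) * Complex.normSq (a f))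
    (fun f => mul_nonneg (sub_nonneg.2 (hv f f.2)) (Complex.normSq_nonneg _)) (fun f => by
      rw [ZeroAtInftyContinuousMap.sub_apply, ZeroAtInftyContinuousMap.smul_apply,
        ZeroAtInftyContinuousMap.smul_apply, ZeroAtInftyContinuousMap.mul_apply,
        ZeroAtInftyContinuousMap.mul_apply, ZeroAtInftyContinuousMap.star_apply, hb,
        Complex.ofReal_mul, Complex.normSq_eq_conj_mul_self, smul_eq_mul, smul_eq_mul,
        RCLike.star_def, Complex.ofReal_sub]
      linear_combination (-(starRingEnd ℂ) (a f) * ((f : WeakDual ℝ V) v : ℂ) * a f) *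
        Complex.I_mul_I) ξ
  have h2 : inner ℂ ξ (π ((-Complex.I) • (star a * b) - (c : ℂ) • (star a * a)) ξ) =
      -Complex.I * inner ℂ (π a ξ) (π b ξ) - (c : ℂ) * ((‖π a ξ‖ ^ 2 : ℝ) : ℂ) := by
    have e1 : ∀ d : C₀(C, ℂ), inner ℂ ξ (π (star a * d) ξ) = inner ℂ (π a ξ) (π d ξ) :=
      fun d => by rw [map_mul, mul_apply_eq_comp, ← inner_rep_apply]
    have e2 : inner ℂ (π a ξ) (π a ξ) = ((‖π a ξ‖ ^ 2 : ℝ) : ℂ) := by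
      rw [inner_self_eq_norm_sq_to_K, Complex.ofReal_pow]; rfl
    rw [← e2, ← e1, ← e1, ← inner_smul_right, ← inner_smul_right, ← inner_sub_right, map_sub,
      map_smul, map_smul]
    rfl
  rw [h2, Complex.sub_re, ← Complex.ofReal_mul, Complex.ofReal_re, sub_nonneg] at h1
  simpa using h1

variable [IsTopologicalAddGroup V] [ContinuousSMul ℝ V]

/-- For `a` with differentiable orbit map, the derivative of `t ↦ η(t v) a` at `0` is the function
`f ↦ i f(v) a(f)`. -/
theorem IsTubeSet.exists_tendsto_etaV_fst (hC : IsTubeSet C) {a : C₀(C, ℂ)}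
    (ha : a ∈ Submodule.span ℂ (expC C '' tube C)) (v : V) :
    ∃ b : C₀(C, ℂ), (∀ f : C, b f = Complex.I * ((f : WeakDual ℝ V) v : ℂ) * a f) ∧
      Tendsto (fun t : ℝ => t⁻¹ •
        ((etaV C (Multiplicative.ofAdd (t • v)) : 𝓜(ℂ, C₀(C, ℂ))).fst a - a)) (𝓝[≠] 0) (𝓝 b) := by
  obtain ⟨-, df, hdf, -⟩ := hC.smoothOn_etaV_fst ha 1
  have h1 : Tendsto (fun t : ℝ => t⁻¹ •
      ((etaV C (Multiplicative.ofAdd (t • v)) : 𝓜(ℂ, C₀(C, ℂ))).fst a - a)) (𝓝[≠] 0)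
      (𝓝 (df (0, v))) := by
    refine (hdf 0 (mem_univ _) v).congr fun t => ?_
    beta_reduce
    rw [zero_add, ofAdd_zero, map_one]
    rfl
  refine ⟨df (0, v), fun f => ?_, h1⟩
  have hev : Continuous fun g : C₀(C, ℂ) => g f :=
    (LipschitzWith.of_dist_le_mul (K := 1) fun p q => by
      rw [NNReal.coe_one, one_mul, dist_eq_norm, dist_eq_norm]
      exact norm_apply_le_norm (p - q) f).continuous
  have h2 := (hev.tendsto _).comp h1
  have h3 : HasDirDeriv (fun x : V => Complex.exp (Complex.I * ((f : WeakDual ℝ V) x : ℂ))) 0 v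
      (Complex.I * ((f : WeakDual ℝ V) v : ℂ)) := hasDirDeriv_exp_dual_zero _ v
  refine tendsto_nhds_unique h2 ((h3.mul_const (a f)).congr fun t => ?_)
  have e0 : (f : WeakDual ℝ V) 0 = 0 := map_zero _
  change _ = t⁻¹ • ((etaV C (Multiplicative.ofAdd (t • v)) : 𝓜(ℂ, C₀(C, ℂ))).fst a f - a f)
  rw [etaV_fst_apply, smul_mul_assoc, sub_mul, zero_add]
  beta_reduce
  rw [e0, Complex.ofReal_zero, mul_zero, Complex.exp_zero, one_mul]

/-- If `f(v) ≥ c` on `C`, then every momentum `l` satisfies `l(v) ≥ c`. For `a` in the span of the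
exponentials, `⟨π(a) ξ, (U(t) - 1) π(a) ξ⟩ / (i t)` tends to the value of the state at the function
`f ↦ f(v) |a(f)|²`, which is at least `c ‖π(a) ξ‖²`; choosing `a` with `π(a) ξ` close to `ξ` changes
the limit by an arbitrarily small amount. -/
theorem IsTubeSet.le_of_mem_momentumImage (hC : IsTubeSet C) {l : WeakDual ℝ V}
    (hl : l ∈ momentumImage (etaV C)) {v : V} {c : ℝ} (hv : ∀ f ∈ C, c ≤ f v) : c ≤ l v := by
  obtain ⟨φ, ψ, -, ⟨H, _, _, _, π, ρ, ξ, hπ, hρ, hξ, -, hψ⟩, hs, hd⟩ := hl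
  simp only [hψ] at hs hd
  obtain ⟨M, hM, hMt⟩ := exists_norm_unitary_sub_le (etaV C) ρ hξ hs hd v
  have hdv : Tendsto (fun t : ℝ => t⁻¹ • (inner ℂ ξ
      (ρ (etaV C (Multiplicative.ofAdd (t • v)) : 𝓜(ℂ, C₀(C, ℂ))) ξ - ξ) : ℂ)) (𝓝[≠] 0)
      (𝓝 (Complex.I * (l v : ℂ))) := by
    refine (hd v).congr fun t => ?_
    beta_reduce
    rw [zero_add, ofAdd_zero, map_one, OneMemClass.coe_one, map_one, one_apply_eq_self,
      inner_sub_right]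
  have key : ∀ a ∈ Submodule.span ℂ (expC C '' tube C), ‖a‖ ≤ 2 →
      c * ‖π a ξ‖ ^ 2 - 3 * M * ‖ξ - π a ξ‖ ≤ l v := fun a ha ha2 => by
    obtain ⟨b, hb, hlim⟩ := hC.exists_tendsto_etaV_fst ha v
    have h3 := norm_sub_inner_rep_le hρ hMt hdv ha2 (fun _ => rfl) hlim
    have h5 := mul_norm_sq_le_im_inner π hv hb ξ
    have h10 := (Complex.abs_im_le_norm _).trans h3
    rw [Complex.sub_im, Complex.I_mul_im, Complex.ofReal_re] at h10
    linarith [(abs_le.1 h10).1]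
  -- Let `π(a) ξ` tend to `ξ`.
  have hlim : Tendsto (fun ε : ℝ => c - 3 * |c| * ε - 3 * M * ε) (𝓝[>] 0) (𝓝 c) := by
    have : Continuous fun ε : ℝ => c - 3 * |c| * ε - 3 * M * ε := by fun_prop
    simpa using (this.tendsto 0).mono_left nhdsWithin_le_nhds
  refine le_of_tendsto hlim ?_
  filter_upwards [Ioo_mem_nhdsGT one_pos] with ε hε
  obtain ⟨a, ha, ha2, haε⟩ := hπ.exists_norm_sub_lt hC.dense_span_expC ξ hε.1
  have h1 := key a ha ha2
  have h2 : |‖π a ξ‖ - 1| ≤ ε := by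
    rw [← hξ, abs_sub_comm]; exact (abs_norm_sub_norm_le _ _).trans haε.le
  have h3 : |‖π a ξ‖ ^ 2 - 1| ≤ 3 * ε := by
    have e : ‖π a ξ‖ ^ 2 - 1 = (‖π a ξ‖ - 1) * (‖π a ξ‖ + 1) := by ring
    have e2 : |‖π a ξ‖ + 1| ≤ 3 := by
      rw [abs_of_nonneg (by positivity)]
      linarith [(abs_le.1 h2).2, hε.2]
    rw [e, abs_mul]
    calc |‖π a ξ‖ - 1| * |‖π a ξ‖ + 1| ≤ ε * 3 := by gcongr; exact hε.1.le
      _ = 3 * ε := by ring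
  have h4 : -(|c| * (3 * ε)) ≤ c * (‖π a ξ‖ ^ 2 - 1) := by
    have := abs_mul c (‖π a ξ‖ ^ 2 - 1)
    have h5 : |c| * |‖π a ξ‖ ^ 2 - 1| ≤ |c| * (3 * ε) := by gcongr
    linarith [neg_abs_le (c * (‖π a ξ‖ ^ 2 - 1))]
  have h6 : 3 * M * ‖ξ - π a ξ‖ ≤ 3 * M * ε := by gcongr
  linarith

theorem IsTubeSet.momentumSet_etaV (hC : IsTubeSet C) : momentumSet (etaV C) = C := by
  have h : momentumImage (etaV C) = C := by
    refine Subset.antisymm (fun l hl => ?_) hC.subset_momentumImage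
    by_contra hlC
    obtain ⟨v, c, h1, h2⟩ := exists_forall_le_of_notMem hC.isClosed hC.convex hlC
    exact absurd (hC.le_of_mem_momentumImage hl h2) (not_le.2 h1)
  rw [momentumSet, h, hC.isClosed.closure_eq]

end Momentum

end HostTube

theorem mainTheorem1 {V : Type u} [AddCommGroup V] [Module ℝ V] [TopologicalSpace V]
    [IsTopologicalAddGroup V] [ContinuousSMul ℝ V] [LocallyConvexSpace ℝ V]
    (C : Set (WeakDual ℝ V)) (hne : C.Nonempty) (hclosed : IsClosed C) (hconv : Convex ℝ C)
    (hint : (interior (HostTube.boundedCone C)).Nonempty)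
    (hbdd : HostTube.LocallyBoundedOn (interior (HostTube.boundedCone C)) (HostTube.supportFn C)) :
    -- (1) the tube is an open complex involutive semigroup, with a locally bounded absolute value
    (HostTube.IsComplexInvSemigroup (HostTube.tube C) (fun s t => s + t) HostTube.Cplx.inv ∧
      HostTube.IsSemigroupAbsValue (HostTube.tube C) (fun s t => s + t) HostTube.Cplx.inv
        (HostTube.alphaC C) ∧
      HostTube.LocallyBoundedOn (HostTube.tube C) (HostTube.alphaC C)) ∧
    -- (2) `C` is locally compact in the weak-star topology
    LocallyCompactSpace C ∧
    -- (3) `γ(s)(f) = exp(i f(s))` induces an isomorphism of C⋆-algebras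
    (∃ γ : HostTube.HolMorphism (HostTube.tube C) (fun s t => s + t) HostTube.Cplx.inv
        (HostTube.alphaC C) C₀(C, ℂ),
      (∀ s ∈ HostTube.tube C, ∀ f : C,
        γ.toFun s f = Complex.exp (Complex.I * HostTube.dualExt (f : WeakDual ℝ V) s)) ∧
      ∃ Φ : HostTube.semigroupCStar (HostTube.tube C) (fun s t => s + t) HostTube.Cplx.inv
          (HostTube.alphaC C) ≃⋆ₐ[ℂ] C₀(C, ℂ),
        ∀ s : HostTube.tube C,
          Φ (HostTube.etaCStar (HostTube.tube C) (fun s t => s + t) HostTube.Cplx.inv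
            (HostTube.alphaC C) s) = γ.toFun s) ∧
    -- (4) host algebra of `V`, strictly smooth multiplier action, momentum set
    (HostTube.IsHostAlgebra.{u, u, w} (HostTube.etaV C) ∧
      HostTube.IsStrictlySmooth (HostTube.etaV C) ∧
      HostTube.momentumSet (HostTube.etaV C) = C) := by
  have hC : HostTube.IsTubeSet C := ⟨hne, hclosed, hconv, hint, hbdd⟩
  exact ⟨⟨HostTube.isComplexInvSemigroup_tube, HostTube.isSemigroupAbsValue_alphaC hne,
      hC.locallyBoundedOn_alphaC⟩,
    HostTube.locallyCompactSpace_of_interior_nonempty hclosed hbdd hint,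
    ⟨hC.gamma, fun _ hs f => hC.expC_apply hs f,
      StarAlgEquiv.ofBijective hC.proj hC.bijective_proj, hC.proj_etaCStar⟩,
    hC.isHostAlgebra_etaV, hC.isStrictlySmooth_etaV, hC.momentumSet_etaV⟩
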